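/- **Notation.** For $x\in\mathbb R^3$ let $x^\times$ be the skew-symmetric matrix with $x^\times y=x\times y$. For $R\in SO(3)$, $v,p\in\mathbb R^3$ let $\mathcal T(R,v,p)=\begin{bmatrix}R&v&p\\0&1&0\\0&0&1\end{bmatrix}\in\mathbb R^{5\times5}$, and $SE_2(3)=\{\mathcal T(R,v,p)\}$. Let $\mathcal R_a(\theta,u)=I_3+\sin\theta\,u^\times+(1-\cos\theta)(u^\times)^2$, $\mathbb P_a(A)=\frac12(A-A^\top)$, and let $\mathbb P$ map a $5\times5$ matrix with upper left $3\times 3$ block $A_1$ and upper right $3\times2$ block $[a_2\ a_3]$ to $\begin{bmatrix}\mathbb P_a(A_1)&a_2&a_3\\0&0&0\end{bmatrix}$; $\mathrm{Ad}_XU=XUX^{-1}$. **Setting.** A rigid body has configuration $X=\mathcal T(R,v,p)$ with $\dot X=f(X,\omega,a):=\begin{bmatrix}R\omega^\times&\mathsf g+Ra&v\\0&0&0\end{bmatrix}$, where $\mathsf g\in\mathbb R^3$ is constant and $\omega,a:[0,\infty)\to\mathbb R^3$ are continuous. Landmarks $p_1,\dots,p_n\in\mathbb R^3$ are given, three of which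 are non-collinear. Put $r_i=(p_i,0,1)\in\mathbb R^5$, $r=[r_1\cdots r_n]$, and let the measurements be $b=[b_1\cdots b_n]=X^{-1}r$. Let $k_i,k_R,k_p,k_v>0$, $k_c=\sum_ik_i$, $p_c=\frac1{k_c}\sum_ik_ip_i$, $r_c=\frac1{k_c}\sum_i k_ir_i$, $b_c=\frac1{k_c}\sum_ik_ib_i$, $M=\sum_ik_i(p_i-p_c)(p_i-p_c)^\top$, $X_c=\mathcal T(I_3,0,p_c)$, $K_n=\mathrm{diag}(k_1,\dots,k_n)$, $K=\begin{bmatrix}k_RI_3&0&0\\0&0&0\\0&k_v&k_p\end{bmatrix}$ and $$\Delta=-\mathrm{Ad}_{X_c}\,\mathbb P\big(X_c^{-1}(r-\hat Xb)K_nr^\top X_c^{-\top}K\big),\qquad \Upsilon(\hat X,r,b)=\tfrac12\sum_ik_i\|(r_i-r_c)-\hat X(b_i-b_c)\|^2 .$$ Let $\theta\in(0,\pi]$, let $\mathbb U\subset\mathbb S^2$ be a nonempty finite set of unit vectors (for instance one that contains an orthonormal eigenbasis of $M$, or any three orthogonal unit vectors), and $$\mathbb Q=\{\mathcal T(R_q,0,(I_3-R_q)p_c)\mid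 R_q=\mathcal R_a(\theta,u),\ u\in\mathbb U\},\qquad \mu_{\mathbb Q}(\hat X,r,b)=\Upsilon(\hat X,r,b)-\min_{X_q\in\mathbb Q}\Upsilon(X_q^{-1}\hat X,r,b),$$ and let $\gamma(\hat X)\subset\mathbb Q$ be the set of minimizers. For $\delta>0$, the observer flows by $\dot{\hat X}=f(\hat X,\omega,a)-\Delta\hat X$ when $\mu_{\mathbb Q}\le\delta$ and jumps by $\hat X^+=X_q^{-1}\hat X$, $X_q\in\gamma(\hat X)$, when $\mu_{\mathbb Q}\ge\delta$. With $X\hat X^{-1}=\mathcal T(\tilde R,\tilde v,\tilde p)$ and $\tilde p_e=\tilde p-(I_3-\tilde R)p_c$, the closed loop $\mathcal H^c_1$ is the hybrid system with state $x=(\hat X,\tilde R,\tilde p_e,\tilde v,t)\in SE_2(3)\times SO(3)\times\mathbb R^3\times\mathbb R^3\times[0,\infty)$ (where $b=X^{-1}r$ with $X=\mathcal T(\tilde R,\tilde v,\tilde p_e+(I_3-\tilde R)p_c)\hat X$), flow $$\dot{\hat X}=f(\hat X,\omega(t),a(t))-\Delta\hat X,\quad \dot{\tilde R}=-k_R\tilde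 R\,\mathbb P_a(M\tilde R),\quad \dot{\tilde p}_e=-k_ck_p\tilde p_e+\tilde v,\quad \dot{\tilde v}=-k_ck_v\tilde p_e+(I_3-\tilde R)\mathsf g,\quad \dot t=1$$ on $\{\mu_{\mathbb Q}(\hat X,r,b)\le\delta\}$, and jumps $(\hat X,\tilde R,\tilde p_e,\tilde v,t)^+=(X_q^{-1}\hat X,\tilde RR_q,\tilde p_e,\tilde v,t)$ with $X_q=\mathcal T(R_q,v_q,p_q)\in\gamma(\hat X)$ on $\{\mu_{\mathbb Q}(\hat X,r,b)\ge\delta\}$. Its solutions are hybrid arcs $x(t,j)$ on hybrid time domains (infinitely many jumps being allowed a priori), locally absolutely continuous in $t$ and satisfying the flow equation almost everywhere. Let $\Delta_M(u,v)=u^\top(\mathrm{tr}(M_v)I_3-M_v)u$ with $M_v=M(I_3-2vv^\top)$, and $\Delta_M^*=\min_v\max_{u\in\mathbb U}\Delta_M(u,v)$, the minimum being over the unit eigenvectors $v$ of $M$. Let $\mathcal A_1=\{\tilde R=I_3,\ \tilde p_e=0,\ \tilde v=0\}$, and let $|x|_{\mathcal A_1}$ be the distance of $x$ to $\mathcal A_1$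 in the metric $\big(\|\hat X-\bar X\|_F^2+\frac18\|\tilde R-\bar R\|_F^2+\|\tilde p_e-\bar p_e\|^2+\|\tilde v-\bar v\|^2+|t-\bar t|^2\big)^{1/2}$. **Theorem 1.** If $0<\delta<(1-\cos\theta)\Delta_M^*$, then every solution of $\mathcal H^c_1$ has finitely many jumps, and $\mathcal A_1$ is uniformly globally exponentially stable: there are $\kappa,\lambda>0$ such that every solution $x$ of $\mathcal H^c_1$ satisfies $$|x(t,j)|_{\mathcal A_1}\le\kappa\,e^{-\lambda(t+j)}\,|x(0,0)|_{\mathcal A_1}\qquad\text{for all }(t,j)\in\operatorname{dom}x .$$ -/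

import Mathlib

open MeasureTheory Matrix

-- Matrices carry the Frobenius norm.
attribute [local instance] Matrix.frobeniusNormedAddCommGroup Matrix.frobeniusNormedSpace

/-! ### Hybrid systems -/

/-- A hybrid system on a subset `space` of an ambient space `E`: a differential equation on the
flow set and a difference inclusion on the jump set. -/
structure HybridSystem (E : Type*) where
  space : Set E
  flowSet : Set E
  flowMap : E → E
  jumpSet : Set E
  jumpMap : E → Set E

/-- `⋃_{j < J} [t_j, t_{j+1}] × {j}` for a finite sequence `0 = t_0 ≤ t_1 ≤ ⋯ ≤ t_J`. -/
def IsCompactHybridTimeDomain (D : Set (ℝ × ℕ)) : Prop :=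
  ∃ (J : ℕ) (τ : ℕ → ℝ), τ 0 = 0 ∧ (∀ j < J, τ j ≤ τ (j + 1)) ∧
    D = {s | s.2 < J ∧ s.1 ∈ Set.Icc (τ s.2) (τ (s.2 + 1))}

/-- A (nonempty) hybrid time domain: all its truncations are compact hybrid time domains.
Infinitely many jumps are allowed. -/
def IsHybridTimeDomain (D : Set (ℝ × ℕ)) : Prop :=
  D.Nonempty ∧ (∀ s ∈ D, 0 ≤ s.1) ∧
    ∀ s ∈ D, IsCompactHybridTimeDomain {s' ∈ D | s'.1 ≤ s.1 ∧ s'.2 ≤ s.2}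

/-- The time interval `I_j = {t | (t, j) ∈ D}`. -/
def flowInterval (D : Set (ℝ × ℕ)) (j : ℕ) : Set ℝ := {t | (t, j) ∈ D}

/-- `x`, restricted to the hybrid time domain `D`, is a solution of the hybrid system `H`;
the values of `x` off `D` are irrelevant. -/
structure IsHybridSolution {E : Type*} [NormedAddCommGroup E] [NormedSpace ℝ E]
    (H : HybridSystem E) (D : Set (ℝ × ℕ)) (x : ℝ → ℕ → E) : Prop where
  timeDomain : IsHybridTimeDomain D
  mem_space : ∀ t j, (t, j) ∈ D → x t j ∈ H.space
  initial : x 0 0 ∈ H.flowSet ∪ H.jumpSet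
  locallyAC : ∀ j, ∀ a ∈ flowInterval D j, ∀ b ∈ flowInterval D j,
    AbsolutelyContinuousOnInterval (fun t => x t j) a b
  flow_mem : ∀ j, ∀ t ∈ interior (flowInterval D j), x t j ∈ H.flowSet
  flow : ∀ j, ∀ᵐ t : ℝ, t ∈ interior (flowInterval D j) →
    HasDerivAt (fun s => x s j) (H.flowMap (x t j)) t
  jump : ∀ t j, (t, j) ∈ D → (t, j + 1) ∈ D →
    x t j ∈ H.jumpSet ∧ x t (j + 1) ∈ H.jumpMap (x t j)

/-- The distance from `x` to the set `A` with respect to the distance function `d`. -/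
noncomputable def distToSet {E : Type*} (d : E → E → ℝ) (A : Set E) (x : E) : ℝ :=
  sInf (d x '' A)

/-- Uniform global exponential stability of `A` for `H`: the same `κ` and `l` serve all solutions. -/
def IsUniformlyGloballyExponentiallyStable {E : Type*} [NormedAddCommGroup E] [NormedSpace ℝ E]
    (H : HybridSystem E) (d : E → E → ℝ) (A : Set E) : Prop :=
  ∃ κ l : ℝ, 0 < κ ∧ 0 < l ∧ ∀ (D : Set (ℝ × ℕ)) (x : ℝ → ℕ → E), IsHybridSolution H D x →
    ∀ t j, (t, j) ∈ D →
      distToSet d A (x t j) ≤ κ * Real.exp (-l * (t + j)) * distToSet d A (x 0 0)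

/-! ### Matrices and the group `SE_2(3)` -/

abbrev V3 := EuclideanSpace ℝ (Fin 3)
abbrev M3 := Matrix (Fin 3) (Fin 3) ℝ
/-- `5 × 5` matrices, with the block structure `3 + 2`. -/
abbrev M5 := Matrix (Fin 3 ⊕ Fin 2) (Fin 3 ⊕ Fin 2) ℝ

/-- The matrix-vector product on Euclidean space. -/
noncomputable def mv (A : M3) (x : V3) : V3 := WithLp.toLp 2 (A *ᵥ x.ofLp)

/-- The skew-symmetric matrix `x^×`, with `x^× y = x × y`. -/
def skew (x : V3) : M3 := !![0, -x 2, x 1; x 2, 0, -x 0; -x 1, x 0, 0]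

/-- The `3 × 2` matrix with columns `v` and `p`. -/
def cols (v p : V3) : Matrix (Fin 3) (Fin 2) ℝ := Matrix.of fun i => ![v i, p i]

def SO3 : Set M3 := {R | R * Rᵀ = 1 ∧ Rᵀ * R = 1 ∧ R.det = 1}

/-- `𝒯(R, v, p)`, with rows `(R v p)`, `(0 1 0)`, `(0 0 1)`. -/
def T (R : M3) (v p : V3) : M5 := Matrix.fromBlocks R (cols v p) 0 1

def SE23 : Set M5 := {X | ∃ R ∈ SO3, ∃ v p : V3, X = T R v p}

/-- The components of `X = 𝒯(R, v, p)`. -/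
def rotPart (X : M5) : M3 := X.toBlocks₁₁
noncomputable def velPart (X : M5) : V3 := WithLp.toLp 2 fun i => X (Sum.inl i) (Sum.inr 0)

/-- The rotation by the angle `θ` about the unit axis `u`. -/
noncomputable def angleAxis (θ : ℝ) (u : V3) : M3 :=
  1 + Real.sin θ • skew u + (1 - Real.cos θ) • (skew u * skew u)

/-- Anti-symmetric projection. -/
noncomputable def antisymPart (A : M3) : M3 := (1 / 2 : ℝ) • (A - Aᵀ)

/-- Projection of a `5 × 5` matrix on the Lie algebra of `SE_2(3)`. -/
noncomputable def projLie (A : M5) : M5 :=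
  Matrix.fromBlocks (antisymPart A.toBlocks₁₁) A.toBlocks₁₂ 0 0

/-- The adjoint map. -/
noncomputable def Ad (X U : M5) : M5 := X * U * X⁻¹

/-! ### The observer -/

/-- The data of the problem and of the observer: landmarks `p_i`, weights `k_i`, gains
`k_R, k_p, k_v`, gravity vector, rotation angle `θ` and set of axes `𝕌` of the transformation set,
and gap `δ`. -/
structure Params (n : ℕ) where
  p : Fin n → V3
  k : Fin n → ℝ
  kR : ℝ
  kp : ℝ
  kv : ℝ
  g : V3
  θ : ℝ
  U : Set V3
  δ : ℝ

namespace Params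

variable {n : ℕ} (P : Params n)

noncomputable def kc : ℝ := ∑ i, P.k i

noncomputable def pc : V3 := (1 / P.kc) • ∑ i, P.k i • P.p i

/-- `M = ∑ k_i (p_i - p_c)(p_i - p_c)ᵀ`. -/
noncomputable def M : M3 :=
  ∑ i, P.k i • Matrix.vecMulVec (P.p i - P.pc).ofLp (P.p i - P.pc).ofLp

/-- The matrix `r` with columns `r_i = (p_i, 0, 1)`. -/
def r : Matrix (Fin 3 ⊕ Fin 2) (Fin n) ℝ :=
  Matrix.of fun s i => Sum.elim (P.p i).ofLp ![0, 1] s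

/-- The measurements `b = X⁻¹ r` when the rigid body has configuration `X`. -/
noncomputable def b (X : M5) : Matrix (Fin 3 ⊕ Fin 2) (Fin n) ℝ := X⁻¹ * P.r

/-- The weighted average `∑ (k_i / k_c) z_i` of the columns of `z`. -/
noncomputable def center (z : Matrix (Fin 3 ⊕ Fin 2) (Fin n) ℝ) : Fin 3 ⊕ Fin 2 → ℝ :=
  ∑ i, (P.k i / P.kc) • z.col i

/-- The cost `Υ(X̂, r, b) = ½ ∑ k_i ‖(r_i - r_c) - X̂ (b_i - b_c)‖²`. -/
noncomputable def cost (X : M5) (r b : Matrix (Fin 3 ⊕ Fin 2) (Fin n) ℝ) : ℝ :=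
  (1 / 2) * ∑ i, P.k i *
    ‖WithLp.toLp 2 ((r.col i - P.center r) - X *ᵥ (b.col i - P.center b))‖ ^ 2

/-- The transformation set `ℚ`. -/
def Q : Set M5 :=
  {X | ∃ u ∈ P.U, X = T (angleAxis P.θ u) 0 (mv (1 - angleAxis P.θ u) P.pc)}

/-- `μ_ℚ(X̂, r, b)`; the infimum is a minimum, since `ℚ` is finite and nonempty. -/
noncomputable def gap (X : M5) (r b : Matrix (Fin 3 ⊕ Fin 2) (Fin n) ℝ) : ℝ :=
  P.cost X r b - sInf ((fun Xq => P.cost (Xq⁻¹ * X) r b) '' P.Q)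

/-- `γ(X̂)`: the minimizers in `ℚ`. -/
def minimizers (X : M5) (r b : Matrix (Fin 3 ⊕ Fin 2) (Fin n) ℝ) : Set M5 :=
  {Xq ∈ P.Q | ∀ Y ∈ P.Q, P.cost (Xq⁻¹ * X) r b ≤ P.cost (Y⁻¹ * X) r b}

/-- `f(X, ω, a)`, the kinematics of the rigid body. -/
noncomputable def f (X : M5) (ω a : V3) : M5 :=
  Matrix.fromBlocks (rotPart X * skew ω) (cols (P.g + mv (rotPart X) a) (velPart X)) 0 0

noncomputable def Xc : M5 := T 1 0 P.pc

/-- The gain matrix `K`, with rows `(k_R I 0 0)`, `(0 0 0)`, `(0 k_v k_p)`. -/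
noncomputable def K : M5 := Matrix.fromBlocks (P.kR • 1) 0 0 !![0, 0; P.kv, P.kp]

/-- The innovation term `Δ = -Ad_{X_c} ℙ(X_c⁻¹ (r - X̂ b) K_n rᵀ X_c⁻ᵀ K)`. -/
noncomputable def innovation (X : M5) (r b : Matrix (Fin 3 ⊕ Fin 2) (Fin n) ℝ) : M5 :=
  -Ad P.Xc (projLie (P.Xc⁻¹ * (r - X * b) * Matrix.diagonal P.k * rᵀ * (P.Xc⁻¹)ᵀ * P.K))

/-! ### The closed loop -/

/-- The ambient space of the extended state `(X̂, R̃, p̃_e, ṽ, t)`. -/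
abbrev State := M5 × M3 × V3 × V3 × ℝ

/-- The configuration `X = X̃ X̂` of the rigid body, where `X̃ = 𝒯(R̃, ṽ, p̃)` and
`p̃ = p̃_e + (I - R̃) p_c`. -/
noncomputable def trueConfig : State → M5
  | (X, R, pe, v, _) => T R v (pe + mv (1 - R) P.pc) * X

/-- The measurements, in terms of the extended state. -/
noncomputable def stateMeas (x : State) : Matrix (Fin 3 ⊕ Fin 2) (Fin n) ℝ := P.b (P.trueConfig x)

def stateSpace : Set State := {x | x.1 ∈ SE23 ∧ x.2.1 ∈ SO3 ∧ 0 ≤ x.2.2.2.2}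

noncomputable def closedLoopFlow (ω a : ℝ → V3) (x : State) : State :=
  match x with
  | (X, R, pe, v, t) =>
    (P.f X (ω t) (a t) - P.innovation X P.r (P.stateMeas x) * X,
      R * (-P.kR • antisymPart (P.M * R)),
      -(P.kc * P.kp) • pe + v,
      -(P.kc * P.kv) • pe + mv (1 - R) P.g,
      1)

def closedLoopJump (x : State) : Set State :=
  match x with
  | (X, R, pe, v, t) =>
    {x' | ∃ Xq ∈ P.minimizers X P.r (P.stateMeas x), x' = (Xq⁻¹ * X, R * rotPart Xq, pe, v, t)}

/-- The closed-loop hybrid system `ℋ₁ᶜ`. -/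
noncomputable def closedLoop (ω a : ℝ → V3) : HybridSystem State where
  space := stateSpace
  flowSet := {x ∈ stateSpace | P.gap x.1 P.r (P.stateMeas x) ≤ P.δ}
  flowMap := P.closedLoopFlow ω a
  jumpSet := {x ∈ stateSpace | P.δ ≤ P.gap x.1 P.r (P.stateMeas x)}
  jumpMap := P.closedLoopJump

/-- The set `𝒜₁ = {R̃ = I, p̃_e = ṽ = 0}`. -/
def attractor : Set State := {x ∈ stateSpace | x.2.1 = 1 ∧ x.2.2.1 = 0 ∧ x.2.2.2.1 = 0}

/-- The distance on the extended state space: Frobenius norm for `X̂`, the normalized distance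
`‖R - R'‖_F / √8` for `R̃`, and Euclidean norms for the other components. -/
noncomputable def stateDist : State → State → ℝ
  | (X, R, pe, v, t), (X', R', pe', v', t') =>
    √(‖X - X'‖ ^ 2 + (1 / 8) * ‖R - R'‖ ^ 2 + ‖pe - pe'‖ ^ 2 + ‖v - v'‖ ^ 2 + (t - t') ^ 2)

/-! ### The bound on the gap -/

/-- Unit eigenvectors. -/
def unitEigenvectors (A : M3) : Set V3 := {v | ‖v‖ = 1 ∧ ∃ c : ℝ, mv A v = c • v}

/-- `Δ_M(u, v) = uᵀ (tr(M_v) I - M_v) u` with `M_v = M (I - 2 v vᵀ)`. -/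
noncomputable def DeltaM (u v : V3) : ℝ :=
  let Mv : M3 := P.M * (1 - (2 : ℝ) • Matrix.vecMulVec v.ofLp v.ofLp)
  u.ofLp ⬝ᵥ ((Mv.trace • (1 : M3) - Mv) *ᵥ u.ofLp)

/-- `Δ_M^* = min_v max_{u ∈ 𝕌} Δ_M(u, v)`, over the unit eigenvectors `v` of `M`. -/
noncomputable def DeltaMStar : ℝ :=
  sInf ((fun v => sSup ((fun u => P.DeltaM u v) '' P.U)) '' unitEigenvectors P.M)

end Params

/-!
The measurements satisfy `X̂ b = X̃⁻¹ r` with `X̃ = X X̂⁻¹`, so the cost depends on the state only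
through the attitude error: it equals `V(R̃) = tr (M (I - R̃))`, and after the rotation by `R_q` it
equals `V(R̃ R_q)` (`Params.cost_state`, `Params.cost_jump`). A jump therefore lowers `V` by the gap,
that is by at least `δ`, while flows do not increase `V`, because its derivative is
`-k_R ‖ℙ_a(M R̃)‖²`. Since `V` is bounded on `SO(3)`, the number of jumps is bounded uniformly over all
solutions (`Params.exists_jump_bound`).

Write `R̃` in Rodrigues' form with axis `u` and cosine `c` (`SO3.exists_eq_axisRotation`). Then
`V = (1 - c) (tr M - uᵀ M u)`, where the second factor is bounded away from zero as the landmarks are not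
collinear, and the axial vector of `2 ℙ_a(M R̃)` is the sum of the orthogonal vectors
`s (tr(M) I - M) u` and `(1 - c) u × M u`. Hence `‖ℙ_a(M R̃)‖² ≥ C (1 + c) V` with `C > 0`, and the only
critical points of `V` besides `I` are the half turns about unit eigenvectors of `M`. At these the gap
is at least `(1 - cos θ) Δ_M^* > δ`, so they lie outside the flow set, and compactness gives
`‖ℙ_a(M R̃)‖² ≥ κ V` on the whole flow set (`Params.exists_gradSq_ge`).

The translational error obeys a stable linear system forced by `(I - R̃) g`, whose square is bounded by
a multiple of `V`. With a quadratic Lyapunov function `W` of this system and `N` large, `N V + W` decays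
exponentially along flows and does not grow at jumps (`Params.exists_lyapunov`). It is comparable with
the squared distance to the attractor, and as the number of jumps is bounded, decay in `t` is decay in
`t + j`. Along absolutely continuous arcs monotonicity follows from the sign of the derivative almost
everywhere by the fundamental theorem of calculus.
-/

/-! ### Rotations of Euclidean space -/

lemma norm_eq_one_iff_sum_sq (u : V3) : ‖u‖ = 1 ↔ u 0 ^ 2 + u 1 ^ 2 + u 2 ^ 2 = 1 := by
  rw [← sq_eq_sq₀ (norm_nonneg u) zero_le_one, EuclideanSpace.real_norm_sq_eq, Fin.sum_univ_three,
    one_pow]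

/-- A rotation fixes a unit vector, because `det (R - 1) = det (1 - R)ᵀ = -det (R - 1)`. -/
lemma SO3.exists_axis {R : M3} (hR : R ∈ SO3) : ∃ u : V3, ‖u‖ = 1 ∧ R *ᵥ u.ofLp = u.ofLp := by
  obtain ⟨h1, h2, h3⟩ := hR
  have hdet : (R - 1).det = 0 := by
    have e : R - 1 = -(R * (R - 1)ᵀ) := by
      rw [transpose_sub, transpose_one, Matrix.mul_sub, h1, Matrix.mul_one, neg_sub]
    have e2 := congrArg Matrix.det e
    rw [det_neg, det_mul, det_transpose, h3, Fintype.card_fin] at e2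
    linarith
  obtain ⟨w, hw0, hw⟩ := Matrix.exists_mulVec_eq_zero_iff.mpr hdet
  have hw1 : R *ᵥ w = w := by
    rw [sub_mulVec, one_mulVec, sub_eq_zero] at hw
    exact hw
  have hne : (WithLp.toLp 2 w : V3) ≠ 0 := by
    intro h
    exact hw0 (by simpa using congrArg WithLp.ofLp h)
  refine ⟨(‖(WithLp.toLp 2 w : V3)‖⁻¹) • (WithLp.toLp 2 w : V3), norm_smul_inv_norm hne, ?_⟩
  rw [WithLp.ofLp_smul, mulVec_smul, hw1]

/-- The adjugate of a rotation is its transpose; taking traces gives `tr R² = (tr R)² - 2 tr R`. -/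
lemma SO3.trace_mul_self {R : M3} (hR : R ∈ SO3) :
    (R * R).trace = R.trace ^ 2 - 2 * R.trace := by
  obtain ⟨h1, h2, h3⟩ := hR
  have hadj : R.adjugate = Rᵀ := by
    calc R.adjugate = R.adjugate * (R * Rᵀ) := by rw [h1, Matrix.mul_one]
      _ = Rᵀ := by rw [← Matrix.mul_assoc, adjugate_mul, h3, one_smul, Matrix.one_mul]
  have h := congrArg Matrix.trace hadj
  rw [adjugate_fin_three] at h
  simp only [trace_fin_three, transpose_apply, of_apply, cons_val] at h
  simp only [trace_fin_three, mul_apply, Fin.sum_univ_three]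
  linear_combination (-2) * h

/-- The rotation with axis `u` whose angle has cosine `c` and sine `s`. -/
def axisRotation (c s : ℝ) (u : V3) : M3 := 1 + s • skew u + (1 - c) • (skew u * skew u)

lemma angleAxis_eq_axisRotation (θ : ℝ) (u : V3) :
    angleAxis θ u = axisRotation (Real.cos θ) (Real.sin θ) u := rfl

/-- Euler's rotation theorem, in Rodrigues' form. With `c = (tr R - 1) / 2`, the symmetric part of
`R` agrees with `c I + (1 - c) u uᵀ`, since the Frobenius norm of the difference vanishes; the axial
vector of the skew part is parallel to `u`. -/
lemma SO3.exists_eq_axisRotation {R : M3} (hR : R ∈ SO3) :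
    ∃ (c s : ℝ) (u : V3), c ^ 2 + s ^ 2 = 1 ∧ ‖u‖ = 1 ∧ R = axisRotation c s u := by
  obtain ⟨u, hu, hRu⟩ := SO3.exists_axis hR
  have htr := SO3.trace_mul_self hR
  obtain ⟨h1, h2, h3⟩ := hR
  have hRtu : Rᵀ *ᵥ u.ofLp = u.ofLp := by
    conv_lhs => rw [← hRu]
    rw [mulVec_mulVec, h2, one_mulVec]
  have hu2 := (norm_eq_one_iff_sum_sq u).1 hu
  have a0 := congrFun hRu 0
  have a1 := congrFun hRu 1
  have a2 := congrFun hRu 2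
  have b0 := congrFun hRtu 0
  have b1 := congrFun hRtu 1
  have b2 := congrFun hRtu 2
  have hF := congrArg Matrix.trace h1
  simp only [mulVec, dotProduct, Fin.sum_univ_three, transpose_apply] at a0 a1 a2 b0 b1 b2
  simp only [trace_fin_three, mul_apply, Fin.sum_univ_three, transpose_apply, one_apply_eq] at hF htr
  clear hRu hRtu h1 h2 h3
  obtain ⟨x, hx⟩ : ∃ x, x = u 0 := ⟨_, rfl⟩
  obtain ⟨y, hy⟩ : ∃ y, y = u 1 := ⟨_, rfl⟩
  obtain ⟨z, hz⟩ : ∃ z, z = u 2 := ⟨_, rfl⟩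
  rw [← hx, ← hy, ← hz] at a0 a1 a2 b0 b1 b2 hu2
  set c := (R 0 0 + R 1 1 + R 2 2 - 1) / 2 with hc
  -- the squared Frobenius norm of `(R + Rᵀ) / 2 - c I - (1 - c) u uᵀ`
  have key : (R 0 0 - c - (1 - c) * x ^ 2) ^ 2 + (R 1 1 - c - (1 - c) * y ^ 2) ^ 2
      + (R 2 2 - c - (1 - c) * z ^ 2) ^ 2
      + 2 * ((R 0 1 + R 1 0) / 2 - (1 - c) * x * y) ^ 2
      + 2 * ((R 0 2 + R 2 0) / 2 - (1 - c) * x * z) ^ 2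
      + 2 * ((R 1 2 + R 2 1) / 2 - (1 - c) * y * z) ^ 2 = 0 := by
    have e1 : R 0 0 + R 1 1 + R 2 2 = 1 + 2 * c := by rw [hc]; ring
    have e2 : R 0 0 ^ 2 + R 1 1 ^ 2 + R 2 2 ^ 2 + 2 * ((R 0 1 + R 1 0) / 2) ^ 2
        + 2 * ((R 0 2 + R 2 0) / 2) ^ 2 + 2 * ((R 1 2 + R 2 1) / 2) ^ 2 = 2 * c ^ 2 + 1 := by
      rw [hc]
      linear_combination (1 / 2) * htr + (1 / 2) * hF
    have e3 : x * (R 0 0 * x + R 0 1 * y + R 0 2 * z) + y * (R 1 0 * x + R 1 1 * y + R 1 2 * z)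
        + z * (R 2 0 * x + R 2 1 * y + R 2 2 * z) = 1 := by
      rw [a0, a1, a2]; linear_combination hu2
    clear_value c
    linear_combination e2 - 2 * c * e1 - 2 * (1 - c) * e3
      + (2 * c * (1 - c) + (1 - c) ^ 2 * (x ^ 2 + y ^ 2 + z ^ 2 + 1)) * hu2
  obtain ⟨k1, k2, k3, k4, k5, k6⟩ : R 0 0 - c - (1 - c) * x ^ 2 = 0 ∧
      R 1 1 - c - (1 - c) * y ^ 2 = 0 ∧ R 2 2 - c - (1 - c) * z ^ 2 = 0 ∧
      (R 0 1 + R 1 0) / 2 - (1 - c) * x * y = 0 ∧ (R 0 2 + R 2 0) / 2 - (1 - c) * x * z = 0 ∧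
      (R 1 2 + R 2 1) / 2 - (1 - c) * y * z = 0 := by
    refine ⟨?_, ?_, ?_, ?_, ?_, ?_⟩ <;> refine pow_eq_zero_iff two_ne_zero |>.1 ?_ <;>
      refine le_antisymm ?_ (sq_nonneg _) <;> rw [← key] <;> linarith [
      sq_nonneg (R 0 0 - c - (1 - c) * x ^ 2), sq_nonneg (R 1 1 - c - (1 - c) * y ^ 2),
      sq_nonneg (R 2 2 - c - (1 - c) * z ^ 2), sq_nonneg ((R 0 1 + R 1 0) / 2 - (1 - c) * x * y),
      sq_nonneg ((R 0 2 + R 2 0) / 2 - (1 - c) * x * z),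
      sq_nonneg ((R 1 2 + R 2 1) / 2 - (1 - c) * y * z)]
  -- the axial vector `w` of the skew part satisfies `w × u = 0`, hence `w = (w ⬝ u) u`
  set w0 := (R 2 1 - R 1 2) / 2 with hw0
  set w1 := (R 0 2 - R 2 0) / 2 with hw1
  set w2 := (R 1 0 - R 0 1) / 2 with hw2
  have c0 : w1 * z - w2 * y = 0 := by rw [hw1, hw2]; linear_combination (a0 - b0) / 2
  have c1 : w2 * x - w0 * z = 0 := by rw [hw0, hw2]; linear_combination (a1 - b1) / 2
  have c2 : w0 * y - w1 * x = 0 := by rw [hw0, hw1]; linear_combination (a2 - b2) / 2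
  set s := w0 * x + w1 * y + w2 * z with hs
  have d0 : w0 = s * x := by rw [hs]; linear_combination -w0 * hu2 + y * c2 - z * c1
  have d1 : w1 = s * y := by rw [hs]; linear_combination -w1 * hu2 - x * c2 + z * c0
  have d2 : w2 = s * z := by rw [hs]; linear_combination -w2 * hu2 + x * c1 - y * c0
  have hw : w0 ^ 2 + w1 ^ 2 + w2 ^ 2 = 1 - c ^ 2 := by
    rw [hw0, hw1, hw2, hc]
    linear_combination (1 / 4) * hF - (1 / 4) * htr
  have hs2 : s ^ 2 = 1 - c ^ 2 := by
    rw [← hw, d0, d1, d2]; linear_combination -s ^ 2 * hu2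
  refine ⟨c, s, u, by linarith, hu, ?_⟩
  clear_value c s
  ext i j
  fin_cases i <;> fin_cases j <;>
    simp [axisRotation, skew, ← hx, ← hy, ← hz]
  · linear_combination k1 + (1 - c) * hu2
  · linear_combination k4 - hw2 - d2
  · linear_combination k5 + hw1 + d1
  · linear_combination k4 + hw2 + d2
  · linear_combination k2 + (1 - c) * hu2
  · linear_combination k6 - hw0 - d0
  · linear_combination k5 - hw1 - d1
  · linear_combination k6 + hw0 + d0
  · linear_combination k3 + (1 - c) * hu2

/-! ### The attitude potential and its gradient -/

/-- The potential `V(R) = tr (M (I - R))` of the attitude error. -/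
def attitudeCost (M R : M3) : ℝ := (M * (1 - R)).trace

/-- The squared Frobenius norm of `ℙ_a(M R)`, which is the gradient of `attitudeCost M` in body
coordinates. -/
noncomputable def gradSq (M R : M3) : ℝ := ((antisymPart (M * R))ᵀ * antisymPart (M * R)).trace

/-- The quadratic form `uᵀ (tr(M) I - M) u` for a unit vector `u`. -/
def axisGain (M : M3) (u : V3) : ℝ := M.trace - u.ofLp ⬝ᵥ (M *ᵥ u.ofLp)

/-- The axial vector of `2 ℙ_a(M R)` for the rotation `R = axisRotation c s u`. -/
def gradAxial (M : M3) (c s : ℝ) (u : V3) : Fin 3 → ℝ :=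
  s • (M.trace • u.ofLp - M *ᵥ u.ofLp) + (1 - c) • (u.ofLp ⨯₃ (M *ᵥ u.ofLp))

lemma symm_entries {M : M3} (hM : Mᵀ = M) : M 1 0 = M 0 1 ∧ M 2 0 = M 0 2 ∧ M 2 1 = M 1 2 :=
  ⟨congrFun (congrFun hM 0) 1, congrFun (congrFun hM 0) 2, congrFun (congrFun hM 1) 2⟩

lemma antisymPart_axisRotation {M : M3} (hM : Mᵀ = M) (c s : ℝ) (u : V3) :
    antisymPart (M * axisRotation c s u) = (1 / 2 : ℝ) • skew (WithLp.toLp 2 (gradAxial M c s u)) := by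
  obtain ⟨h1, h2, h3⟩ := symm_entries hM
  rw [antisymPart]
  congr 1
  ext i j
  fin_cases i <;> fin_cases j <;>
    simp [axisRotation, skew, mul_apply, Fin.sum_univ_three, gradAxial, cross_apply, mulVec,
      dotProduct, trace_fin_three, h1, h2, h3] <;> ring

lemma trace_transpose_mul_skew (w : Fin 3 → ℝ) :
    ((skew (WithLp.toLp 2 w))ᵀ * skew (WithLp.toLp 2 w)).trace = 2 * (w ⬝ᵥ w) := by
  simp [trace_fin_three, skew, mul_apply, Fin.sum_univ_three, dotProduct]
  ring

/-- The two summands of `gradAxial` are orthogonal. -/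
lemma gradSq_axisRotation {M : M3} (hM : Mᵀ = M) (c s : ℝ) (u : V3) :
    gradSq M (axisRotation c s u) = (1 / 2) *
      (s ^ 2 * ((M.trace • u.ofLp - M *ᵥ u.ofLp) ⬝ᵥ (M.trace • u.ofLp - M *ᵥ u.ofLp)) +
        (1 - c) ^ 2 * ((u.ofLp ⨯₃ (M *ᵥ u.ofLp)) ⬝ᵥ (u.ofLp ⨯₃ (M *ᵥ u.ofLp)))) := by
  rw [gradSq, antisymPart_axisRotation hM, transpose_smul, smul_mul_smul_comm, trace_smul,
    trace_transpose_mul_skew, gradAxial]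
  have h1 : (M.trace • u.ofLp - M *ᵥ u.ofLp) ⬝ᵥ (u.ofLp ⨯₃ (M *ᵥ u.ofLp)) = 0 := by
    rw [sub_dotProduct, smul_dotProduct, dot_self_cross, dot_cross_self]; simp
  have h2 : (u.ofLp ⨯₃ (M *ᵥ u.ofLp)) ⬝ᵥ (M.trace • u.ofLp - M *ᵥ u.ofLp) = 0 := by
    rw [dotProduct_comm, h1]
  simp only [add_dotProduct, dotProduct_add, smul_dotProduct, dotProduct_smul, h1, h2, smul_eq_mul]
  ring

lemma dot_self_eq_one {u : V3} (hu : ‖u‖ = 1) : u.ofLp ⬝ᵥ u.ofLp = 1 := by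
  rw [dotProduct, Fin.sum_univ_three]
  linear_combination (norm_eq_one_iff_sum_sq u).1 hu

/-- The symmetric matrix `tr(M) I - M` satisfies `|(tr(M) I - M) u| ≥ uᵀ (tr(M) I - M) u`. -/
lemma axisGain_sq_le {M : M3} {u : V3} (hu : ‖u‖ = 1) :
    axisGain M u ^ 2 ≤
      (M.trace • u.ofLp - M *ᵥ u.ofLp) ⬝ᵥ (M.trace • u.ofLp - M *ᵥ u.ofLp) := by
  have h := dot_self_eq_one hu
  set y := M.trace • u.ofLp - M *ᵥ u.ofLp with hy
  have hg : axisGain M u = u.ofLp ⬝ᵥ y := by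
    rw [hy, dotProduct_sub, dotProduct_smul, h, axisGain, smul_eq_mul, mul_one]
  have hnn : 0 ≤ (y - (u.ofLp ⬝ᵥ y) • u.ofLp) ⬝ᵥ (y - (u.ofLp ⬝ᵥ y) • u.ofLp) :=
    Finset.sum_nonneg fun i _ => mul_self_nonneg _
  simp only [sub_dotProduct, dotProduct_sub, smul_dotProduct, dotProduct_smul, h, smul_eq_mul,
    dotProduct_comm y u.ofLp] at hnn
  rw [hg]
  linarith

lemma attitudeCost_axisRotation {M : M3} (hM : Mᵀ = M) (c s : ℝ) {u : V3} (hu : ‖u‖ = 1) :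
    attitudeCost M (axisRotation c s u) = (1 - c) * axisGain M u := by
  obtain ⟨h1, h2, h3⟩ := symm_entries hM
  have hu2 := (norm_eq_one_iff_sum_sq u).1 hu
  simp [attitudeCost, axisGain, axisRotation, skew, mul_apply, Fin.sum_univ_three, mulVec,
    dotProduct, trace_fin_three, h1, h2, h3]
  linear_combination (1 - c) * (M 0 0 + M 1 1 + M 2 2) * hu2

lemma trace_axisRotation (c s : ℝ) {u : V3} (hu : ‖u‖ = 1) :
    (axisRotation c s u).trace = 1 + 2 * c := by
  have hu2 := (norm_eq_one_iff_sum_sq u).1 hu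
  simp [axisRotation, skew, trace_fin_three]
  linear_combination (-2) * (1 - c) * hu2

lemma frobenius_norm_sq (A : M3) : ‖A‖ ^ 2 = (Aᵀ * A).trace := by
  rw [frobenius_norm_def, ← Real.sqrt_eq_rpow, Real.sq_sqrt]
  · simp [trace_fin_three, mul_apply, Fin.sum_univ_three]
    ring
  · exact Finset.sum_nonneg fun i _ => Finset.sum_nonneg fun j _ => by positivity

lemma norm_sub_one_sq {R : M3} (hR : R ∈ SO3) : ‖R - 1‖ ^ 2 = 2 * (3 - R.trace) := by
  rw [frobenius_norm_sq, transpose_sub, transpose_one, Matrix.sub_mul, Matrix.mul_sub, hR.2.1,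
    Matrix.mul_one, Matrix.one_mul, trace_sub, trace_sub, trace_sub, trace_transpose, trace_one,
    Fintype.card_fin]
  push_cast
  ring

section Bounds

variable {M : M3} {R : M3} {c₀ c₁ : ℝ}

lemma cos_mem {c s : ℝ} (h : c ^ 2 + s ^ 2 = 1) : -1 ≤ c ∧ c ≤ 1 :=
  abs_le.1 (abs_le_one_iff_mul_self_le_one.2 (by nlinarith [sq_nonneg s]))

lemma attitudeCost_bounds (hM : Mᵀ = M)
    (h₀ : ∀ u : V3, ‖u‖ = 1 → c₀ ≤ axisGain M u)
    (h₁ : ∀ u : V3, ‖u‖ = 1 → axisGain M u ≤ c₁) (hR : R ∈ SO3) :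
    c₀ / 4 * ‖R - 1‖ ^ 2 ≤ attitudeCost M R ∧ attitudeCost M R ≤ c₁ / 4 * ‖R - 1‖ ^ 2 := by
  rw [norm_sub_one_sq hR]
  obtain ⟨c, s, u, hcs, hu, rfl⟩ := SO3.exists_eq_axisRotation hR
  rw [attitudeCost_axisRotation hM c s hu, trace_axisRotation c s hu]
  have hc := cos_mem hcs
  constructor <;> nlinarith [h₀ u hu, h₁ u hu]

lemma norm_sub_one_sq_le (hR : R ∈ SO3) : ‖R - 1‖ ^ 2 ≤ 8 := by
  rw [norm_sub_one_sq hR]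
  obtain ⟨c, s, u, hcs, hu, rfl⟩ := SO3.exists_eq_axisRotation hR
  rw [trace_axisRotation c s hu]
  linarith [(cos_mem hcs).1]

/-- The gradient dominates the potential except near the rotations by `π`. -/
lemma gradSq_ge (hM : Mᵀ = M) (hc₀ : 0 < c₀)
    (h₀ : ∀ u : V3, ‖u‖ = 1 → c₀ ≤ axisGain M u) (hR : R ∈ SO3) :
    c₀ / 4 * (R.trace + 1) * attitudeCost M R ≤ gradSq M R := by
  obtain ⟨c, s, u, hcs, hu, rfl⟩ := SO3.exists_eq_axisRotation hR
  rw [attitudeCost_axisRotation hM c s hu, trace_axisRotation c s hu, gradSq_axisRotation hM]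
  have hc := cos_mem hcs
  have h1 := axisGain_sq_le (M := M) hu
  have h2 : 0 ≤ (u.ofLp ⨯₃ (M *ᵥ u.ofLp)) ⬝ᵥ (u.ofLp ⨯₃ (M *ᵥ u.ofLp)) :=
    Finset.sum_nonneg fun i _ => mul_self_nonneg _
  have h3 := h₀ u hu
  have hs : s ^ 2 = (1 + c) * (1 - c) := by linarith
  have h4 : c₀ * axisGain M u ≤ axisGain M u ^ 2 := by nlinarith
  have h5 : 0 ≤ (1 + c) * (1 - c) := by nlinarith
  have h6 := mul_le_mul_of_nonneg_left (h4.trans h1) h5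
  have h7 := mul_nonneg (sq_nonneg (1 - c)) h2
  rw [hs]
  linarith

/-- The critical points of the potential are the identity and the half turns about the eigenvectors
of `M`. -/
lemma critical_points (hM : Mᵀ = M) (hc₀ : 0 < c₀)
    (h₀ : ∀ u : V3, ‖u‖ = 1 → c₀ ≤ axisGain M u) (hR : R ∈ SO3) (hΦ : gradSq M R ≤ 0) :
    R = 1 ∨ ∃ v : V3, v ∈ Params.unitEigenvectors M ∧
      R = (2 : ℝ) • vecMulVec v.ofLp v.ofLp - 1 := by
  obtain ⟨c, s, u, hcs, hu, rfl⟩ := SO3.exists_eq_axisRotation hR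
  rw [gradSq_axisRotation hM] at hΦ
  have h1 := axisGain_sq_le (M := M) hu
  have hnn : 0 ≤ (u.ofLp ⨯₃ (M *ᵥ u.ofLp)) ⬝ᵥ (u.ofLp ⨯₃ (M *ᵥ u.ofLp)) :=
    Finset.sum_nonneg fun i _ => mul_self_nonneg _
  have h3 := h₀ u hu
  have hpos : 0 < (M.trace • u.ofLp - M *ᵥ u.ofLp) ⬝ᵥ (M.trace • u.ofLp - M *ᵥ u.ofLp) :=
    lt_of_lt_of_le (pow_pos (hc₀.trans_le h3) 2) h1
  have hs : s = 0 := by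
    by_contra hs
    have := mul_pos (pow_pos (abs_pos.2 hs) 2) hpos
    rw [sq_abs] at this
    nlinarith [mul_nonneg (sq_nonneg (1 - c)) hnn]
  subst hs
  have hc : (c - 1) * (c + 1) = 0 := by linear_combination hcs
  rcases mul_eq_zero.1 hc with hc | hc
  · left
    have : c = 1 := by linarith
    simp [axisRotation, this]
  · right
    obtain rfl : c = -1 := by linarith
    have hcr : u.ofLp ⨯₃ (M *ᵥ u.ofLp) = 0 :=
      dotProduct_self_eq_zero.1 (le_antisymm (by linarith) hnn)
    have hu2 := (norm_eq_one_iff_sum_sq u).1 hu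
    refine ⟨u, ⟨hu, u.ofLp ⬝ᵥ (M *ᵥ u.ofLp), ?_⟩, ?_⟩
    · -- `y = (u ⬝ y) u - u × (u × y)` for the unit vector `u` and `y = M u`
      rw [cross_apply] at hcr
      have e0 := congrFun hcr 0
      have e1 := congrFun hcr 1
      have e2 := congrFun hcr 2
      simp only [cons_val, Pi.zero_apply] at e0 e1 e2
      rw [mv]
      set y := M *ᵥ u.ofLp
      ext i
      simp only [dotProduct, Fin.sum_univ_three, PiLp.smul_apply, smul_eq_mul]
      fin_cases i
      · simp; linear_combination (-y 0) * hu2 - u 1 * e2 + u 2 * e1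
      · simp; linear_combination (-y 1) * hu2 + u 0 * e2 - u 2 * e0
      · simp; linear_combination (-y 2) * hu2 - u 0 * e1 + u 1 * e0
    · ext i j
      fin_cases i <;> fin_cases j <;>
        simp [axisRotation, skew, vecMulVec_apply]
      · linear_combination (-2) * hu2
      · ring
      · ring
      · ring
      · linear_combination (-2) * hu2
      · ring
      · ring
      · ring
      · linear_combination (-2) * hu2

end Bounds

/-! ### The landmark matrix -/

namespace Params

variable {n : ℕ} (P : Params n)

lemma M_transpose : P.Mᵀ = P.M := by
  simp only [M, transpose_sum, transpose_smul, transpose_vecMulVec]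

/-- `tr(M) - uᵀ M u` is the weighted sum of the squared distances of the landmarks from the line
through `p_c` with direction `u`. -/
lemma axisGain_M {u : V3} (hu : ‖u‖ = 1) :
    axisGain P.M u = ∑ i, P.k i * ‖(P.p i - P.pc) - inner ℝ u (P.p i - P.pc) • u‖ ^ 2 := by
  have h1 : ∀ q : V3, ‖q - inner ℝ u q • u‖ ^ 2 = q.ofLp ⬝ᵥ q.ofLp - (u.ofLp ⬝ᵥ q.ofLp) ^ 2 := by
    intro q
    rw [norm_sub_sq_real, norm_smul, hu, inner_smul_right, real_inner_comm, mul_one,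
      ← real_inner_self_eq_norm_sq, Real.norm_eq_abs, sq_abs, PiLp.inner_apply, PiLp.inner_apply]
    simp only [RCLike.inner_apply, conj_trivial, dotProduct, Fin.sum_univ_three]
    ring
  simp only [h1, axisGain, M, trace_sum, trace_smul, sum_mulVec, smul_mulVec, dotProduct_sum,
    dotProduct_smul, ← Finset.sum_sub_distrib, smul_eq_mul, vecMulVec_mulVec, trace_vecMulVec,
    op_smul_eq_smul]
  refine Finset.sum_congr rfl fun i _ => ?_
  rw [dotProduct_comm (P.p i - P.pc).ofLp u.ofLp]
  ring

lemma axisGain_M_pos (hp : ∃ i j l : Fin n, ¬ Collinear ℝ {P.p i, P.p j, P.p l})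
    (hk : ∀ i, 0 < P.k i) {u : V3} (hu : ‖u‖ = 1) : 0 < axisGain P.M u := by
  rw [P.axisGain_M hu]
  have hnn : ∀ i, 0 ≤ P.k i * ‖(P.p i - P.pc) - inner ℝ u (P.p i - P.pc) • u‖ ^ 2 :=
    fun i => mul_nonneg (hk i).le (sq_nonneg _)
  refine lt_of_le_of_ne (Finset.sum_nonneg fun i _ => hnn i) fun h => ?_
  -- otherwise all landmarks lie on the line through `p_c` with direction `u`
  obtain ⟨i, j, l, hcol⟩ := hp
  refine hcol ((collinear_iff_exists_forall_eq_smul_vadd _).2 ⟨P.pc, u, ?_⟩)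
  have hz : ∀ i, P.p i = inner ℝ u (P.p i - P.pc) • u + P.pc := by
    intro i
    have h0 := (Finset.sum_eq_zero_iff_of_nonneg fun i _ => hnn i).1 h.symm i (Finset.mem_univ i)
    rcases mul_eq_zero.1 h0 with h0 | h0
    · exact absurd h0 (hk i).ne'
    · have h2 := norm_eq_zero.1 (pow_eq_zero_iff two_ne_zero |>.1 h0)
      rw [sub_eq_zero] at h2
      rw [← h2, sub_add_cancel]
  rintro q (rfl | rfl | rfl)
  exacts [⟨_, hz i⟩, ⟨_, hz j⟩, ⟨_, hz l⟩]

lemma continuous_axisGain (M : M3) : Continuous (axisGain M) := by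
  unfold axisGain
  simp only [dotProduct, mulVec, Fin.sum_univ_three]
  fun_prop

lemma exists_axisGain_bounds (hp : ∃ i j l : Fin n, ¬ Collinear ℝ {P.p i, P.p j, P.p l})
    (hk : ∀ i, 0 < P.k i) : ∃ c₀ c₁ : ℝ, 0 < c₀ ∧ 0 < c₁ ∧
      (∀ u : V3, ‖u‖ = 1 → c₀ ≤ axisGain P.M u) ∧ ∀ u : V3, ‖u‖ = 1 → axisGain P.M u ≤ c₁ := by
  have hne : (Metric.sphere (0 : V3) 1).Nonempty := NormedSpace.sphere_nonempty.2 zero_le_one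
  have hs := isCompact_sphere (0 : V3) 1
  obtain ⟨u, hu, hmin⟩ := hs.exists_isMinOn hne (continuous_axisGain P.M).continuousOn
  obtain ⟨w, hw, hmax⟩ := hs.exists_isMaxOn hne (continuous_axisGain P.M).continuousOn
  refine ⟨_, _, P.axisGain_M_pos hp hk (by simpa using hu), P.axisGain_M_pos hp hk (by simpa using hw),
    fun v hv => hmin (a := v) (by simpa using hv), fun v hv => hmax (a := v) (by simpa using hv)⟩

/-! ### The gap at the undesired critical points -/

lemma DeltaM_eq_neg_axisGain {u : V3} (hu : ‖u‖ = 1) (v : V3) :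
    P.DeltaM u v = -axisGain (P.M * ((2 : ℝ) • vecMulVec v.ofLp v.ofLp - 1)) u := by
  have h : P.M * (1 - (2 : ℝ) • vecMulVec v.ofLp v.ofLp) =
      -(P.M * ((2 : ℝ) • vecMulVec v.ofLp v.ofLp - 1)) := by
    rw [← Matrix.mul_neg, neg_sub]
  simp only [DeltaM, h, axisGain, sub_mulVec, smul_mulVec, one_mulVec, dotProduct_sub,
    dotProduct_smul, dot_self_eq_one hu, trace_neg, neg_mulVec, dotProduct_neg, smul_eq_mul]
  ring

lemma continuous_DeltaM (u : V3) : Continuous (P.DeltaM u) := by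
  unfold DeltaM
  simp [dotProduct, mulVec, Fin.sum_univ_three, trace_fin_three, mul_apply, vecMulVec_apply]
  fun_prop

/-- At every unit eigenvector `v` some axis attains the bound `Δ_M^*`. -/
lemma exists_DeltaMStar_le (hUfin : P.U.Finite) (hUne : P.U.Nonempty) {v : V3}
    (hv : v ∈ unitEigenvectors P.M) : ∃ u ∈ P.U, P.DeltaMStar ≤ P.DeltaM u v := by
  obtain ⟨u₀, hu₀⟩ := hUne
  have hfin : ∀ w, ((fun u => P.DeltaM u w) '' P.U).Finite := fun w => hUfin.image _
  obtain ⟨B, hB⟩ := (isCompact_sphere (0 : V3) 1).bddBelow_image (P.continuous_DeltaM u₀).continuousOn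
  have hbdd : BddBelow ((fun v => sSup ((fun u => P.DeltaM u v) '' P.U)) ''
      unitEigenvectors P.M) := by
    refine ⟨B, ?_⟩
    rintro _ ⟨w, hw, rfl⟩
    exact (hB ⟨w, by simpa using hw.1, rfl⟩).trans
      (le_csSup (hfin w).bddAbove ⟨u₀, hu₀, rfl⟩)
  obtain ⟨u, hu, he⟩ := (show ((fun u => P.DeltaM u v) '' P.U).Nonempty from
    ⟨_, u₀, hu₀, rfl⟩).csSup_mem (hfin v)
  exact ⟨u, hu, (csInf_le hbdd ⟨v, hv, rfl⟩).trans_eq he.symm⟩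

/-- The decrease `V(R) - V(R R_u)` of the potential under the rotation `R_u = angleAxis P.θ u`. -/
noncomputable def costDrop (R : M3) (u : V3) : ℝ := (P.M * R * (angleAxis P.θ u - 1)).trace

lemma costDrop_half_turn {u v : V3} (hu : ‖u‖ = 1) (hv : v ∈ unitEigenvectors P.M) :
    P.costDrop ((2 : ℝ) • vecMulVec v.ofLp v.ofLp - 1) u =
      (1 - Real.cos P.θ) * P.DeltaM u v := by
  obtain ⟨hv1, c, hc⟩ := hv
  set S := P.M * ((2 : ℝ) • vecMulVec v.ofLp v.ofLp - 1) with hS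
  have hMv : P.M *ᵥ v.ofLp = c • v.ofLp := by simpa [mv] using congrArg WithLp.ofLp hc
  have hsymm : Sᵀ = S := by
    rw [hS, Matrix.mul_sub, mul_smul_comm, mul_vecMulVec, hMv, Matrix.mul_one, transpose_sub,
      transpose_smul, transpose_vecMulVec, P.M_transpose, vecMulVec_smul, smul_vecMulVec]
  rw [DeltaM_eq_neg_axisGain P hu, costDrop, ← hS]
  have h := attitudeCost_axisRotation hsymm (Real.cos P.θ) (Real.sin P.θ) hu
  rw [← angleAxis_eq_axisRotation, attitudeCost] at h
  rw [mul_neg, ← h, ← neg_sub (1 : M3), Matrix.mul_neg, trace_neg]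

/-! ### Decay of the potential on the flow set -/

lemma isCompact_SO3 : IsCompact SO3 := by
  have hcl : IsClosed SO3 := by
    have e : SO3 = {R : M3 | R * Rᵀ = 1} ∩ ({R : M3 | Rᵀ * R = 1} ∩ {R : M3 | R.det = 1}) := by
      ext R; simp [SO3]
    rw [e]
    exact (isClosed_eq (by fun_prop) continuous_const).inter
      ((isClosed_eq (by fun_prop) continuous_const).inter
        (isClosed_eq (by fun_prop) continuous_const))
  have hK : IsCompact (Set.univ.pi fun _ : Fin 3 => Set.univ.pi fun _ : Fin 3 =>
      Set.Icc (-1 : ℝ) 1) := isCompact_univ_pi fun _ => isCompact_univ_pi fun _ => isCompact_Icc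
  refine IsCompact.of_isClosed_subset (X := M3) hK hcl fun R hR i _ j _ => ?_
  have h := congrFun (congrFun hR.1 i) i
  rw [mul_apply, one_apply_eq] at h
  have h1 : R i j * R i j ≤ 1 := by
    rw [← h]
    exact Finset.single_le_sum (f := fun l => R i l * Rᵀ l i) (fun l _ => mul_self_nonneg _)
      (Finset.mem_univ j)
  exact abs_le.1 (abs_le_one_iff_mul_self_le_one.2 h1)

/-- On the flow set the squared gradient dominates the potential. Where `tr R ≥ 1` this is
`gradSq_ge`. The rest of the flow set is compact and contains no critical point, because the gap
exceeds `δ` at the half turns about the eigenvectors of `M`. -/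
lemma exists_gradSq_ge (hp : ∃ i j l : Fin n, ¬ Collinear ℝ {P.p i, P.p j, P.p l})
    (hk : ∀ i, 0 < P.k i) (hUfin : P.U.Finite) (hUne : P.U.Nonempty) (hU : ∀ u ∈ P.U, ‖u‖ = 1)
    (hδM : P.δ < (1 - Real.cos P.θ) * P.DeltaMStar) :
    ∃ κ : ℝ, 0 < κ ∧ ∀ R ∈ SO3, (∀ u ∈ P.U, P.costDrop R u ≤ P.δ) →
      κ * attitudeCost P.M R ≤ gradSq P.M R := by
  obtain ⟨c₀, c₁, hc₀, hc₁, h₀, h₁⟩ := P.exists_axisGain_bounds hp hk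
  have hV : ∀ R ∈ SO3, 0 ≤ attitudeCost P.M R ∧ attitudeCost P.M R ≤ 2 * c₁ := by
    intro R hR
    obtain ⟨h2, h3⟩ := attitudeCost_bounds P.M_transpose h₀ h₁ hR
    have h4 := norm_sub_one_sq_le hR
    constructor
    · exact le_trans (by positivity) h2
    · nlinarith
  set F : Set M3 := SO3 ∩ ({R | R.trace ≤ 1} ∩ ⋂ u ∈ P.U, {R | P.costDrop R u ≤ P.δ}) with hF
  have hFc : IsCompact F := by
    refine isCompact_SO3.inter_right (IsClosed.inter ?_ (isClosed_biInter fun u _ => ?_))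
    · exact isClosed_le (by fun_prop) continuous_const
    · unfold costDrop
      exact isClosed_le (by fun_prop) continuous_const
  have hΦ : Continuous (gradSq P.M) := by
    unfold gradSq antisymPart
    fun_prop
  have hpos : ∀ R ∈ F, 0 < gradSq P.M R := by
    rintro R ⟨hR, htr, hgap⟩
    by_contra hle
    rcases critical_points P.M_transpose hc₀ h₀ hR (not_lt.1 hle) with rfl | ⟨v, hv, rfl⟩
    · norm_num [trace_one] at htr
    · obtain ⟨u, hu, hΔ⟩ := P.exists_DeltaMStar_le hUfin hUne hv
      have h3 : P.costDrop _ u ≤ P.δ := Set.mem_iInter₂.1 hgap u hu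
      rw [P.costDrop_half_turn (hU u hu) hv] at h3
      have h4 : 0 ≤ 1 - Real.cos P.θ := by linarith [Real.cos_le_one P.θ]
      linarith [mul_le_mul_of_nonneg_left hΔ h4]
  obtain ⟨ε, hε, hmin⟩ : ∃ ε : ℝ, 0 < ε ∧ ∀ R ∈ F, ε ≤ gradSq P.M R := by
    rcases F.eq_empty_or_nonempty with he | hne
    · exact ⟨1, one_pos, by simp [he]⟩
    · obtain ⟨R, hR, hmin⟩ := hFc.exists_isMinOn hne hΦ.continuousOn
      exact ⟨_, hpos R hR, fun S hS => hmin hS⟩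
  refine ⟨min (c₀ / 2) (ε / (2 * c₁)), by positivity, fun R hR hgap => ?_⟩
  obtain ⟨hV0, hV1⟩ := hV R hR
  rcases le_total R.trace 1 with htr | htr
  · calc _ ≤ ε / (2 * c₁) * (2 * c₁) := by
          gcongr
          exact min_le_right _ _
      _ = ε := by field_simp
      _ ≤ _ := hmin R ⟨hR, htr, Set.mem_iInter₂.2 hgap⟩
  · refine le_trans ?_ (gradSq_ge P.M_transpose hc₀ h₀ hR)
    gcongr
    refine (min_le_left _ _).trans ?_
    nlinarith

end Params

/-! ### The measured cost as a function of the attitude error -/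

/-- Extension of a vector of `ℝ³` by two zeros. -/
def inl5 (q : Fin 3 → ℝ) : Fin 3 ⊕ Fin 2 → ℝ := Sum.elim q 0

lemma T_mulVec_inl5 (R : M3) (v p : V3) (q : Fin 3 → ℝ) : T R v p *ᵥ inl5 q = inl5 (R *ᵥ q) := by
  rw [T, inl5, fromBlocks_mulVec]
  ext i
  rcases i with i | i <;> simp [inl5]

lemma isUnit_det_T {R : M3} (hR : R * Rᵀ = 1) (v p : V3) : IsUnit (T R v p).det := by
  rw [T, det_fromBlocks_zero₂₁, det_one, mul_one]
  refine isUnit_iff_ne_zero.2 fun h => ?_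
  have := congrArg Matrix.det hR
  rw [det_mul, h, zero_mul, det_one] at this
  exact zero_ne_one this

lemma T_inv_mulVec_inl5 {R : M3} (hR : R * Rᵀ = 1) (v p : V3) (q : Fin 3 → ℝ) :
    (T R v p)⁻¹ *ᵥ inl5 q = inl5 (Rᵀ *ᵥ q) := by
  have h : T R v p *ᵥ inl5 (Rᵀ *ᵥ q) = inl5 q := by
    rw [T_mulVec_inl5, mulVec_mulVec, hR, one_mulVec]
  rw [← h, mulVec_mulVec, nonsing_inv_mul _ (isUnit_det_T hR v p), one_mulVec]

lemma angleAxis_mul_transpose (θ : ℝ) {u : V3} (hu : ‖u‖ = 1) :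
    angleAxis θ u * (angleAxis θ u)ᵀ = 1 := by
  have hu2 := (norm_eq_one_iff_sum_sq u).1 hu
  have h3 : skew u * skew u * skew u = -skew u := by
    have e : skew u * skew u * skew u = -((u 0 ^ 2 + u 1 ^ 2 + u 2 ^ 2) • skew u) := by
      ext i j
      fin_cases i <;> fin_cases j <;> simp [skew] <;> ring
    rw [e, hu2, one_smul]
  have ht : (skew u)ᵀ = -skew u := by
    ext i j
    fin_cases i <;> fin_cases j <;> simp [skew]
  have h4 : skew u * skew u * (skew u * skew u) = -(skew u * skew u) := by
    rw [← Matrix.mul_assoc, h3, Matrix.neg_mul]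
  have h3' : skew u * (skew u * skew u) = -skew u := by rw [← Matrix.mul_assoc, h3]
  have hcs := Real.sin_sq_add_cos_sq θ
  rw [angleAxis, transpose_add, transpose_add, transpose_one, transpose_smul, transpose_smul,
    transpose_mul, ht, neg_mul_neg]
  simp only [Matrix.add_mul, Matrix.mul_add, Matrix.one_mul, Matrix.mul_one, smul_mul_smul_comm, h4,
    Matrix.mul_neg, h3, h3', smul_neg]
  have : Real.sin θ * Real.sin θ = 1 - Real.cos θ ^ 2 := by linarith
  rw [this]
  module

namespace Params

variable {n : ℕ} (P : Params n)

lemma kc_pos (hp : ∃ i j l : Fin n, ¬ Collinear ℝ {P.p i, P.p j, P.p l}) (hk : ∀ i, 0 < P.k i) :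
    0 < P.kc := by
  obtain ⟨i, -⟩ := hp
  exact Finset.sum_pos (fun i _ => hk i) ⟨i, Finset.mem_univ i⟩

lemma center_mul (A : M5) (z : Matrix (Fin 3 ⊕ Fin 2) (Fin n) ℝ) :
    P.center (A * z) = A *ᵥ P.center z := by
  simp only [center, mulVec_sum, mulVec_smul]
  rfl

lemma r_sub_center (hkc : P.kc ≠ 0) (i : Fin n) :
    P.r.col i - P.center P.r = inl5 (P.p i - P.pc).ofLp := by
  have hs : ∑ i, P.k i / P.kc = 1 := by
    rw [← Finset.sum_div]; exact div_self hkc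
  ext s
  rcases s with s | s
  · simp [r, center, inl5, pc, Finset.sum_apply, Finset.mul_sum, div_eq_inv_mul, mul_assoc, col]
  · fin_cases s
    · simp [r, center, inl5, Finset.sum_apply, col]
    · simp [r, center, inl5, Finset.sum_apply, col, hs]

/-- The cost depends on the estimate `Y` and the true configuration `Z` only through the rotation `Sᵀ`
by which `Y Z⁻¹` acts on the landmarks relative to their weighted centre. -/
lemma cost_eq {S : M3} (hkc : P.kc ≠ 0) (hS : S * Sᵀ = 1) (Y Z : M5)
    (h : ∀ q, Y *ᵥ (Z⁻¹ *ᵥ inl5 q) = inl5 (Sᵀ *ᵥ q)) :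
    P.cost Y P.r (P.b Z) = attitudeCost P.M S := by
  have h1 : ∀ i, ‖WithLp.toLp 2 ((P.r.col i - P.center P.r) -
      Y *ᵥ ((P.b Z).col i - P.center (P.b Z)))‖ ^ 2 =
      2 * ((P.p i - P.pc).ofLp ⬝ᵥ ((1 - S) *ᵥ (P.p i - P.pc).ofLp)) := by
    intro i
    have e : (P.b Z).col i - P.center (P.b Z) = Z⁻¹ *ᵥ (P.r.col i - P.center P.r) := by
      rw [b, center_mul, mulVec_sub]
      rfl
    set q := (P.p i - P.pc).ofLp
    rw [e, P.r_sub_center hkc, h, EuclideanSpace.real_norm_sq_eq, Fintype.sum_sum_type]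
    simp only [inl5, Pi.sub_apply, Sum.elim_inl, Sum.elim_inr, Pi.zero_apply, sub_zero]
    have e2 : ∑ j, (q j - (Sᵀ *ᵥ q) j) ^ 2 = (q - Sᵀ *ᵥ q) ⬝ᵥ (q - Sᵀ *ᵥ q) :=
      Finset.sum_congr rfl fun j _ => by rw [Pi.sub_apply]; ring
    have e3 : (Sᵀ *ᵥ q) ⬝ᵥ (Sᵀ *ᵥ q) = q ⬝ᵥ q := by
      rw [dotProduct_mulVec, vecMul_transpose, mulVec_mulVec, hS, one_mulVec]
    have e4 : q ⬝ᵥ (Sᵀ *ᵥ q) = q ⬝ᵥ (S *ᵥ q) := by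
      rw [dotProduct_mulVec, vecMul_transpose, dotProduct_comm]
    rw [e2, sub_dotProduct, dotProduct_sub, dotProduct_sub, e3, dotProduct_comm (Sᵀ *ᵥ q) q, e4,
      sub_mulVec, one_mulVec, dotProduct_sub]
    simp
    ring
  simp only [cost, h1, attitudeCost, M, Finset.sum_mul, trace_sum, Finset.mul_sum]
  refine Finset.sum_congr rfl fun i _ => ?_
  rw [smul_mul_assoc, trace_smul, vecMulVec_mul, trace_vecMulVec, dotProduct_mulVec, smul_eq_mul,
    dotProduct_comm]
  ring

/-- The element of the transformation set `ℚ` with axis `u`. -/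
noncomputable def Tq (u : V3) : M5 := T (angleAxis P.θ u) 0 (mv (1 - angleAxis P.θ u) P.pc)

lemma isUnit_det_of_mem_SE23 {X : M5} (hX : X ∈ SE23) : IsUnit X.det := by
  obtain ⟨R, hR, v, p, rfl⟩ := hX
  exact isUnit_det_T hR.1 v p

lemma trueConfig_inv_mulVec {x : State} (hx : x ∈ stateSpace) (q : Fin 3 → ℝ) :
    x.1 *ᵥ ((P.trueConfig x)⁻¹ *ᵥ inl5 q) = inl5 (x.2.1ᵀ *ᵥ q) := by
  obtain ⟨X, R, pe, v, t⟩ := x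
  obtain ⟨hX, hR, -⟩ := hx
  rw [trueConfig, Matrix.mul_inv_rev, mulVec_mulVec, ← Matrix.mul_assoc,
    mul_nonsing_inv _ (isUnit_det_of_mem_SE23 hX), Matrix.one_mul, T_inv_mulVec_inl5 hR.1]

lemma cost_state (hkc : P.kc ≠ 0) {x : State} (hx : x ∈ stateSpace) :
    P.cost x.1 P.r (P.stateMeas x) = attitudeCost P.M x.2.1 :=
  P.cost_eq hkc hx.2.1.1 _ _ (P.trueConfig_inv_mulVec hx)

lemma cost_jump (hkc : P.kc ≠ 0) {x : State} (hx : x ∈ stateSpace) {u : V3} (hu : ‖u‖ = 1) :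
    P.cost ((P.Tq u)⁻¹ * x.1) P.r (P.stateMeas x) =
      attitudeCost P.M (x.2.1 * angleAxis P.θ u) := by
  have ho := angleAxis_mul_transpose P.θ hu
  refine P.cost_eq hkc ?_ _ _ fun q => ?_
  · rw [transpose_mul, Matrix.mul_assoc, ← Matrix.mul_assoc (angleAxis P.θ u), ho, Matrix.one_mul,
      hx.2.1.1]
  · rw [← mulVec_mulVec, P.trueConfig_inv_mulVec hx, Tq, T_inv_mulVec_inl5 ho, mulVec_mulVec,
      transpose_mul]

lemma Q_eq_image : P.Q = P.Tq '' P.U := by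
  ext X
  simp [Q, Tq, eq_comm]

/-- No rotation of the transformation set decreases the potential by more than the gap. -/
lemma costDrop_le_gap (hkc : P.kc ≠ 0) (hUfin : P.U.Finite) (hU : ∀ u ∈ P.U, ‖u‖ = 1) {x : State}
    (hx : x ∈ stateSpace) {u : V3} (hu : u ∈ P.U) :
    P.costDrop x.2.1 u ≤ P.gap x.1 P.r (P.stateMeas x) := by
  have hQ : P.Q.Finite := by rw [P.Q_eq_image]; exact hUfin.image _
  have h1 := csInf_le (hQ.image fun Xq => P.cost (Xq⁻¹ * x.1) P.r (P.stateMeas x)).bddBelow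
    ⟨P.Tq u, ⟨u, hu, rfl⟩, rfl⟩
  beta_reduce at h1
  rw [P.cost_jump hkc hx (hU u hu)] at h1
  have h2 : P.costDrop x.2.1 u =
      attitudeCost P.M x.2.1 - attitudeCost P.M (x.2.1 * angleAxis P.θ u) := by
    simp only [costDrop, attitudeCost, Matrix.mul_sub, Matrix.mul_one, trace_sub, Matrix.mul_assoc]
    ring
  rw [gap, P.cost_state hkc hx, h2]
  linarith

/-- A jump decreases the potential by the value of the gap. -/
lemma attitudeCost_jump (hkc : P.kc ≠ 0) (hU : ∀ u ∈ P.U, ‖u‖ = 1) {x : State}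
    (hx : x ∈ stateSpace) {Xq : M5} (hq : Xq ∈ P.minimizers x.1 P.r (P.stateMeas x)) :
    attitudeCost P.M (x.2.1 * rotPart Xq) =
      attitudeCost P.M x.2.1 - P.gap x.1 P.r (P.stateMeas x) := by
  obtain ⟨hQ, hmin⟩ := hq
  have hinf : sInf ((fun Xq => P.cost (Xq⁻¹ * x.1) P.r (P.stateMeas x)) '' P.Q) =
      P.cost (Xq⁻¹ * x.1) P.r (P.stateMeas x) :=
    IsLeast.csInf_eq ⟨⟨Xq, hQ, rfl⟩, by rintro _ ⟨Y, hY, rfl⟩; exact hmin Y hY⟩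
  rw [gap, hinf, P.cost_state hkc hx]
  obtain ⟨u, hu, rfl⟩ := hQ
  have := P.cost_jump hkc hx (hU u hu)
  rw [Tq] at this
  rw [this]
  simp [rotPart, T]

end Params

/-! ### Monotone quantities along hybrid arcs -/

lemma AbsolutelyContinuousOnInterval.lipschitz_comp {X Y : Type*} [PseudoMetricSpace X]
    [PseudoMetricSpace Y] {f : ℝ → X} {g : X → Y} {K : NNReal} {a b : ℝ} (hg : LipschitzWith K g)
    (hf : AbsolutelyContinuousOnInterval f a b) :
    AbsolutelyContinuousOnInterval (fun t => g (f t)) a b := by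
  unfold AbsolutelyContinuousOnInterval at *
  refine squeeze_zero (fun E => Finset.sum_nonneg fun _ _ => dist_nonneg) (fun E => ?_)
    (by simpa using hf.const_mul (K : ℝ))
  rw [Finset.mul_sum]
  exact Finset.sum_le_sum fun _ _ => hg.dist_le_mul _ _

lemma AbsolutelyContinuousOnInterval.const {a b : ℝ} (c : ℝ) :
    AbsolutelyContinuousOnInterval (fun _ => c) a b :=
  (LipschitzWith.const c).lipschitzOnWith.absolutelyContinuousOnInterval

lemma AbsolutelyContinuousOnInterval.euclidean_inner {f g : ℝ → V3} {a b : ℝ}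
    (hf : AbsolutelyContinuousOnInterval f a b) (hg : AbsolutelyContinuousOnInterval g a b) :
    AbsolutelyContinuousOnInterval (fun t => inner ℝ (f t) (g t)) a b := by
  have h : ∀ {f : ℝ → V3}, AbsolutelyContinuousOnInterval f a b → ∀ i,
      AbsolutelyContinuousOnInterval (fun t => f t i) a b := fun hf i =>
    hf.lipschitz_comp (EuclideanSpace.proj (𝕜 := ℝ) i : V3 →L[ℝ] ℝ).lipschitz
  have e : (fun t => inner ℝ (f t) (g t)) =
      fun t => f t 0 * g t 0 + f t 1 * g t 1 + f t 2 * g t 2 := by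
    funext t
    rw [PiLp.inner_apply, Fin.sum_univ_three]
    simp only [RCLike.inner_apply, conj_trivial]
    ring
  rw [e]
  exact (((h hf 0).fun_mul (h hg 0)).add ((h hf 1).fun_mul (h hg 1))).add ((h hf 2).fun_mul (h hg 2))

lemma AbsolutelyContinuousOnInterval.le_of_deriv_nonpos {f f' : ℝ → ℝ} {a b : ℝ} (hab : a ≤ b)
    (hf : AbsolutelyContinuousOnInterval f a b)
    (h : ∀ᵐ t, t ∈ Set.Ioo a b → HasDerivAt f (f' t) t ∧ f' t ≤ 0) : f b ≤ f a := by
  have hi := hf.integral_deriv_eq_sub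
  have hn : ∫ t in a..b, deriv f t ≤ 0 := by
    rw [intervalIntegral.integral_of_le hab, integral_Ioc_eq_integral_Ioo]
    refine integral_nonpos_of_ae ?_
    rw [Filter.EventuallyLE, ae_restrict_iff' measurableSet_Ioo]
    filter_upwards [h] with t ht hmem
    rw [(ht hmem).1.deriv]
    exact (ht hmem).2
  linarith

lemma IsHybridTimeDomain.zero_mem {D : Set (ℝ × ℕ)} (hD : IsHybridTimeDomain D) : (0, 0) ∈ D := by
  obtain ⟨⟨s, hs⟩, h0, h⟩ := hD
  obtain ⟨J, τ, hτ0, hτ, he⟩ := h s hs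
  have h1 : s ∈ {s' ∈ D | s'.1 ≤ s.1 ∧ s'.2 ≤ s.2} := ⟨hs, le_rfl, le_rfl⟩
  rw [he] at h1
  have h2 : ((0 : ℝ), (0 : ℕ)) ∈ {s' ∈ D | s'.1 ≤ s.1 ∧ s'.2 ≤ s.2} := by
    rw [he]
    have hJ : 0 < J := lt_of_le_of_lt (Nat.zero_le _) h1.1
    have := hτ 0 hJ
    rw [hτ0] at this
    exact ⟨hJ, by simp [hτ0], this⟩
  exact h2.1

/-- A quantity that does not increase along flows and drops by at least `d` at every jump has dropped
by at least `d * j` after `j` jumps. -/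
lemma IsHybridTimeDomain.add_mul_le {D : Set (ℝ × ℕ)} (hD : IsHybridTimeDomain D)
    {φ : ℝ → ℕ → ℝ} {d : ℝ}
    (hflow : ∀ j a b, a ≤ b → (∀ t ∈ Set.Icc a b, (t, j) ∈ D) → φ b j ≤ φ a j)
    (hjump : ∀ t j, (t, j) ∈ D → (t, j + 1) ∈ D → φ t (j + 1) ≤ φ t j - d)
    {t : ℝ} {j : ℕ} (htj : (t, j) ∈ D) : φ t j + d * j ≤ φ 0 0 := by
  obtain ⟨J, τ, hτ0, hτ, he⟩ := hD.2.2 (t, j) htj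
  have h1 : (t, j) ∈ {s' ∈ D | s'.1 ≤ t ∧ s'.2 ≤ j} := ⟨htj, le_rfl, le_rfl⟩
  rw [he] at h1
  have hmem : ∀ i < J, ∀ s ∈ Set.Icc (τ i) (τ (i + 1)), (s, i) ∈ D := by
    intro i hi s hs
    have : (s, i) ∈ {s' ∈ D | s'.1 ≤ t ∧ s'.2 ≤ j} := by rw [he]; exact ⟨hi, hs⟩
    exact this.1
  have key : ∀ i < J, ∀ s ∈ Set.Icc (τ i) (τ (i + 1)), φ s i + d * i ≤ φ 0 0 := by
    intro i
    induction i with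
    | zero =>
      intro hi s hs
      have := hflow 0 (τ 0) s hs.1 fun r hr => hmem 0 hi r ⟨hr.1, hr.2.trans hs.2⟩
      rw [hτ0] at this
      simpa using this
    | succ i ih =>
      intro hi s hs
      have hi' : i < J := by omega
      have h2 := ih hi' (τ (i + 1)) ⟨hτ i hi', le_rfl⟩
      have h3 := hjump (τ (i + 1)) i (hmem i hi' _ ⟨hτ i hi', le_rfl⟩)
        (hmem (i + 1) hi _ ⟨le_rfl, hτ (i + 1) hi⟩)
      have h4 := hflow (i + 1) (τ (i + 1)) s hs.1 fun r hr =>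
        hmem (i + 1) hi r ⟨hr.1, hr.2.trans hs.2⟩
      push_cast
      linarith
  exact key j h1.1 t h1.2

lemma Ioo_subset_interior_flowInterval {D : Set (ℝ × ℕ)} {j : ℕ} {a b : ℝ}
    (h : ∀ t ∈ Set.Icc a b, (t, j) ∈ D) : Set.Ioo a b ⊆ interior (flowInterval D j) :=
  interior_maximal (fun t ht => h t (Set.Ioo_subset_Icc_self ht)) isOpen_Ioo

/-! ### The translational subsystem -/

/-- Quadratic Lyapunov function of the system `ṗ = -a p + v`, `v̇ = -b p`. -/
noncomputable def transLyapunov (b ε : ℝ) (p v : V3) : ℝ :=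
  (1 / 2) * inner ℝ v v + (b / 2) * inner ℝ p p - ε * inner ℝ p v

/-- The derivative of `transLyapunov b ε` in the direction `(p', v')`. -/
noncomputable def transLyapunovDeriv (b ε : ℝ) (p v p' v' : V3) : ℝ :=
  inner ℝ v v' + b * inner ℝ p p' - ε * (inner ℝ p v' + inner ℝ p' v)

lemma hasDerivAt_transLyapunov (b ε : ℝ) {p v : ℝ → V3} {p' v' : V3} {t : ℝ}
    (hp : HasDerivAt p p' t) (hv : HasDerivAt v v' t) :
    HasDerivAt (fun s => transLyapunov b ε (p s) (v s))
      (transLyapunovDeriv b ε (p t) (v t) p' v') t := by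
  have h := (((hv.inner ℝ hv).const_mul (1 / 2)).add ((hp.inner ℝ hp).const_mul (b / 2))).sub
    ((hp.inner ℝ hv).const_mul ε)
  refine h.congr_deriv ?_
  rw [transLyapunovDeriv, real_inner_comm (v t) v', real_inner_comm (p t) p']
  ring

/-- The system `ṗ = -a p + v`, `v̇ = -b p + h` is input-to-state stable with a quadratic Lyapunov
function; the cross term has a small coefficient `ε`. -/
lemma exists_transLyapunov {a b : ℝ} (ha : 0 < a) (hb : 0 < b) :
    ∃ ε m₀ m₁ α β : ℝ, 0 < m₀ ∧ 0 < m₁ ∧ 0 < α ∧ 0 ≤ β ∧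
      (∀ p v : V3, m₀ * (‖p‖ ^ 2 + ‖v‖ ^ 2) ≤ transLyapunov b ε p v ∧
        transLyapunov b ε p v ≤ m₁ * (‖p‖ ^ 2 + ‖v‖ ^ 2)) ∧
      ∀ p v h : V3, transLyapunovDeriv b ε p v (-a • p + v) (-b • p + h) ≤
        -α * (‖p‖ ^ 2 + ‖v‖ ^ 2) + β * ‖h‖ ^ 2 := by
  obtain ⟨ε, hε, e1, e2, e3⟩ : ∃ ε : ℝ, 0 < ε ∧ ε ≤ a / 4 ∧ ε * a ≤ b / 2 ∧ ε ^ 2 ≤ b / 4 := by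
    refine ⟨min (a / 4) (min (b / 2 / a) (Real.sqrt (b / 4))), by positivity, min_le_left _ _, ?_, ?_⟩
    · rw [← le_div_iff₀ ha]
      exact (min_le_right _ _).trans (min_le_left _ _)
    · calc _ ≤ Real.sqrt (b / 4) ^ 2 := by
            gcongr
            exact (min_le_right _ _).trans (min_le_right _ _)
        _ = b / 4 := Real.sq_sqrt (by positivity)
  have hab : 0 < a * b := mul_pos ha hb
  have hcs : ∀ p v : V3, |inner ℝ p v| ≤ ‖p‖ * ‖v‖ := abs_real_inner_le_norm
  refine ⟨ε, min (1 / 4) (b / 4), max (3 / 4) (3 * b / 4), (3 / 8) * min (a * b) ε,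
    2 / ε + 2 * ε ^ 2 / (a * b), by positivity, by positivity, by positivity, by positivity, ?_, ?_⟩
  · intro p v
    have h1 := abs_le.1 (hcs p v)
    have h2 : ε * (‖p‖ * ‖v‖) ≤ (1 / 4) * ‖v‖ ^ 2 + b / 4 * ‖p‖ ^ 2 := by
      nlinarith [sq_nonneg (ε * ‖p‖ - (1 / 2) * ‖v‖),
        mul_le_mul_of_nonneg_right e3 (sq_nonneg ‖p‖)]
    have h3 := mul_le_mul_of_nonneg_left h1.1 hε.le
    have h4 := mul_le_mul_of_nonneg_left h1.2 hε.le
    rw [transLyapunov, real_inner_self_eq_norm_sq, real_inner_self_eq_norm_sq]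
    have m1 := mul_le_mul_of_nonneg_right (min_le_left (1 / 4 : ℝ) (b / 4)) (sq_nonneg ‖v‖)
    have m2 := mul_le_mul_of_nonneg_right (min_le_right (1 / 4 : ℝ) (b / 4)) (sq_nonneg ‖p‖)
    have m3 := mul_le_mul_of_nonneg_right (le_max_left (3 / 4 : ℝ) (3 * b / 4)) (sq_nonneg ‖v‖)
    have m4 := mul_le_mul_of_nonneg_right (le_max_right (3 / 4 : ℝ) (3 * b / 4)) (sq_nonneg ‖p‖)
    constructor <;> linarith
  · intro p v h
    have h1 : ε * a * inner ℝ p v ≤ ε / 2 * ‖v‖ ^ 2 + a * b / 4 * ‖p‖ ^ 2 := by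
      have := mul_le_mul_of_nonneg_left (abs_le.1 (hcs p v)).2 (mul_pos hε ha).le
      have h5 := mul_le_mul_of_nonneg_right (mul_le_mul_of_nonneg_right e2 ha.le) (sq_nonneg ‖p‖)
      nlinarith [mul_nonneg hε.le (sq_nonneg (a * ‖p‖ - ‖v‖))]
    have h2 : inner ℝ v h ≤ ε / 8 * ‖v‖ ^ 2 + 2 / ε * ‖h‖ ^ 2 := by
      refine (abs_le.1 (hcs v h)).2.trans ?_
      have : ε / 8 * ‖v‖ ^ 2 + 2 / ε * ‖h‖ ^ 2 - ‖v‖ * ‖h‖ =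
          (ε * ‖v‖ - 4 * ‖h‖) ^ 2 / (8 * ε) := by field_simp; ring
      have : 0 ≤ (ε * ‖v‖ - 4 * ‖h‖) ^ 2 / (8 * ε) := by positivity
      linarith
    have h3 : -(ε * inner ℝ p h) ≤ a * b / 8 * ‖p‖ ^ 2 + 2 * ε ^ 2 / (a * b) * ‖h‖ ^ 2 := by
      have h5 := mul_le_mul_of_nonneg_left (abs_le.1 (hcs p h)).1 hε.le
      have : a * b / 8 * ‖p‖ ^ 2 + 2 * ε ^ 2 / (a * b) * ‖h‖ ^ 2 - ε * (‖p‖ * ‖h‖) =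
          (a * b * ‖p‖ - 4 * ε * ‖h‖) ^ 2 / (8 * (a * b)) := by field_simp; ring
      have : 0 ≤ (a * b * ‖p‖ - 4 * ε * ‖h‖) ^ 2 / (8 * (a * b)) := by positivity
      linarith
    have h4 : ε * b * ‖p‖ ^ 2 ≤ a * b / 4 * ‖p‖ ^ 2 := by
      have := mul_le_mul_of_nonneg_right (mul_le_mul_of_nonneg_right e1 hb.le) (sq_nonneg ‖p‖)
      linarith
    have m1 := mul_le_mul_of_nonneg_right (min_le_left (a * b) ε) (sq_nonneg ‖p‖)
    have m2 := mul_le_mul_of_nonneg_right (min_le_right (a * b) ε) (sq_nonneg ‖v‖)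
    simp only [transLyapunovDeriv, inner_add_right, inner_add_left, inner_smul_left,
      inner_smul_right, conj_trivial, real_inner_self_eq_norm_sq, real_inner_comm p v]
    linarith

/-! ### Distance to the attractor -/

lemma one_mem_SO3 : (1 : M3) ∈ SO3 := by simp [SO3]

lemma norm_mv_le (A : M3) (g : V3) : ‖mv A g‖ ≤ ‖A‖ * ‖g‖ := by
  have h := frobenius_norm_mul A (replicateCol (Fin 1) g.ofLp)
  rw [← replicateCol_mulVec] at h
  calc ‖mv A g‖ = ‖replicateCol (Fin 1) (A *ᵥ g.ofLp)‖ := (frobenius_norm_replicateCol _).symm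
    _ ≤ ‖A‖ * ‖replicateCol (Fin 1) g.ofLp‖ := h
    _ = ‖A‖ * ‖g‖ := congrArg (‖A‖ * ·) (frobenius_norm_replicateCol _)

namespace Params

/-- The squared distance of a state to the attractor. -/
noncomputable def errorSq (x : State) : ℝ :=
  (1 / 8) * ‖x.2.1 - 1‖ ^ 2 + ‖x.2.2.1‖ ^ 2 + ‖x.2.2.2.1‖ ^ 2

lemma distToSet_attractor {x : State} (hx : x ∈ stateSpace) :
    distToSet stateDist attractor x = √(errorSq x) := by
  obtain ⟨X, R, pe, v, t⟩ := x
  refine IsLeast.csInf_eq ⟨⟨(X, 1, 0, 0, t), ⟨⟨hx.1, one_mem_SO3, hx.2.2⟩, rfl, rfl, rfl⟩, ?_⟩, ?_⟩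
  · simp [stateDist, errorSq]
  · rintro _ ⟨⟨Y, S, q, w, s⟩, ⟨-, hS, hq, hw⟩, rfl⟩
    simp only at hS hq hw
    subst hS hq hw
    simp only [stateDist, errorSq, sub_zero]
    refine Real.sqrt_le_sqrt ?_
    nlinarith [sq_nonneg ‖X - Y‖, sq_nonneg (t - s)]

variable {n : ℕ} (P : Params n)

/-! ### Closed-loop solutions -/

/-- The linear part of the potential. -/
noncomputable def costLin (M : M3) : M3 →L[ℝ] ℝ :=
  LinearMap.toContinuousLinearMap
    { toFun := fun R => (M * R).trace
      map_add' := fun A B => by rw [Matrix.mul_add, trace_add]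
      map_smul' := fun c A => by rw [mul_smul_comm, trace_smul, RingHom.id_apply] }

lemma costLin_apply (M R : M3) : costLin M R = (M * R).trace := rfl

lemma attitudeCost_eq (M R : M3) : attitudeCost M R = M.trace - costLin M R := by
  rw [attitudeCost, Matrix.mul_sub, Matrix.mul_one, trace_sub, costLin_apply]

/-- Along flows the potential decreases at the rate `k_R ‖ℙ_a(M R)‖²`. -/
lemma costLin_flow (M R : M3) (kR : ℝ) :
    costLin M (R * (-kR • antisymPart (M * R))) = kR * gradSq M R := by
  have h : ∀ A : M3, (A * antisymPart A).trace = -((antisymPart A)ᵀ * antisymPart A).trace := by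
    intro A
    have e : ∀ B : M3, (B * antisymPart B).trace = (1 / 2) * ((B * B).trace - (B * Bᵀ).trace) := by
      intro B
      rw [antisymPart, mul_smul_comm, trace_smul, Matrix.mul_sub, trace_sub, smul_eq_mul]
    have h1 : (Aᵀ * Aᵀ).trace = (A * A).trace := by
      rw [← transpose_mul, trace_transpose]
    rw [e, antisymPart, transpose_smul, smul_mul_smul_comm, trace_smul, transpose_sub,
      transpose_transpose]
    simp only [Matrix.sub_mul, Matrix.mul_sub, trace_sub, smul_eq_mul, h1, trace_mul_comm Aᵀ A]
    ring
  rw [costLin_apply, ← Matrix.mul_assoc, mul_smul_comm, trace_smul, h, gradSq, smul_eq_mul]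
  ring

section Solution

variable {P} {ω a : ℝ → V3} {D : Set (ℝ × ℕ)} {x : ℝ → ℕ → State}

lemma ae_hasDerivAt_of_solution (hx : IsHybridSolution (P.closedLoop ω a) D x) {j : ℕ} {t₀ t₁ : ℝ}
    (h : ∀ t ∈ Set.Icc t₀ t₁, (t, j) ∈ D) :
    ∀ᵐ t : ℝ, t ∈ Set.Ioo t₀ t₁ → x t j ∈ (P.closedLoop ω a).flowSet ∧
      HasDerivAt (fun s => (x s j).2.1)
        ((x t j).2.1 * (-P.kR • antisymPart (P.M * (x t j).2.1))) t ∧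
      HasDerivAt (fun s => (x s j).2.2.1)
        (-(P.kc * P.kp) • (x t j).2.2.1 + (x t j).2.2.2.1) t ∧
      HasDerivAt (fun s => (x s j).2.2.2.1)
        (-(P.kc * P.kv) • (x t j).2.2.1 + mv (1 - (x t j).2.1) P.g) t := by
  filter_upwards [hx.flow j] with t ht hmem
  have hint := Ioo_subset_interior_flowInterval h hmem
  have hd := ht hint
  have h2 : HasDerivAt (fun s => (x s j).2) (P.closedLoopFlow ω a (x t j)).2 t :=
    (ContinuousLinearMap.snd ℝ M5 (M3 × V3 × V3 × ℝ)).hasFDerivAt.comp_hasDerivAt t hd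
  have h3 : HasDerivAt (fun s => (x s j).2.2) (P.closedLoopFlow ω a (x t j)).2.2 t :=
    (ContinuousLinearMap.snd ℝ M3 (V3 × V3 × ℝ)).hasFDerivAt.comp_hasDerivAt t h2
  have h4 : HasDerivAt (fun s => (x s j).2.2.2) (P.closedLoopFlow ω a (x t j)).2.2.2 t :=
    (ContinuousLinearMap.snd ℝ V3 (V3 × ℝ)).hasFDerivAt.comp_hasDerivAt t h3
  exact ⟨hx.flow_mem j t hint,
    (ContinuousLinearMap.fst ℝ M3 (V3 × V3 × ℝ)).hasFDerivAt.comp_hasDerivAt t h2,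
    (ContinuousLinearMap.fst ℝ V3 (V3 × ℝ)).hasFDerivAt.comp_hasDerivAt t h3,
    (ContinuousLinearMap.fst ℝ V3 ℝ).hasFDerivAt.comp_hasDerivAt t h4⟩

lemma absolutelyContinuous_attitudeCost {t₀ t₁ : ℝ} {y : ℝ → State} (M : M3)
    (hy : AbsolutelyContinuousOnInterval y t₀ t₁) :
    AbsolutelyContinuousOnInterval (fun t => attitudeCost M (y t).2.1) t₀ t₁ := by
  have h2 : AbsolutelyContinuousOnInterval (fun t => (y t).2) t₀ t₁ :=
    hy.lipschitz_comp LipschitzWith.prod_snd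
  have hR : AbsolutelyContinuousOnInterval (fun t => (y t).2.1) t₀ t₁ :=
    h2.lipschitz_comp LipschitzWith.prod_fst
  have hl : AbsolutelyContinuousOnInterval (fun t => costLin M (y t).2.1) t₀ t₁ :=
    hR.lipschitz_comp (costLin M).lipschitz
  simp only [attitudeCost_eq]
  exact (AbsolutelyContinuousOnInterval.const _).sub hl

lemma absolutelyContinuous_transLyapunov {t₀ t₁ : ℝ} {y : ℝ → State} (b ε : ℝ)
    (hy : AbsolutelyContinuousOnInterval y t₀ t₁) :
    AbsolutelyContinuousOnInterval (fun t => transLyapunov b ε (y t).2.2.1 (y t).2.2.2.1) t₀ t₁ := by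
  have h2 : AbsolutelyContinuousOnInterval (fun t => (y t).2) t₀ t₁ :=
    hy.lipschitz_comp LipschitzWith.prod_snd
  have h3 : AbsolutelyContinuousOnInterval (fun t => (y t).2.2) t₀ t₁ :=
    h2.lipschitz_comp LipschitzWith.prod_snd
  have h4 : AbsolutelyContinuousOnInterval (fun t => (y t).2.2.2) t₀ t₁ :=
    h3.lipschitz_comp LipschitzWith.prod_snd
  have hp : AbsolutelyContinuousOnInterval (fun t => (y t).2.2.1) t₀ t₁ :=
    h3.lipschitz_comp LipschitzWith.prod_fst
  have hv : AbsolutelyContinuousOnInterval (fun t => (y t).2.2.2.1) t₀ t₁ :=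
    h4.lipschitz_comp LipschitzWith.prod_fst
  exact (((hv.euclidean_inner hv).const_mul (1 / 2)).add
    ((hp.euclidean_inner hp).const_mul (b / 2))).sub ((hp.euclidean_inner hv).const_mul ε)

lemma hasDerivAt_attitudeCost (M : M3) (kR : ℝ) {R : ℝ → M3} {t : ℝ}
    (hR : HasDerivAt R (R t * (-kR • antisymPart (M * R t))) t) :
    HasDerivAt (fun s => attitudeCost M (R s)) (-(kR * gradSq M (R t))) t := by
  have h1 := ((costLin M).hasFDerivAt.comp_hasDerivAt t hR).const_sub M.trace
  simp only [attitudeCost_eq]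
  exact h1.congr_deriv (congrArg Neg.neg (costLin_flow M (R t) kR))

lemma attitudeCost_flow (hx : IsHybridSolution (P.closedLoop ω a) D x) (hkR : 0 < P.kR)
    {j : ℕ} {t₀ t₁ : ℝ} (h01 : t₀ ≤ t₁) (h : ∀ t ∈ Set.Icc t₀ t₁, (t, j) ∈ D) :
    attitudeCost P.M (x t₁ j).2.1 ≤ attitudeCost P.M (x t₀ j).2.1 := by
  have hac := hx.locallyAC j t₀ (h _ ⟨le_rfl, h01⟩) t₁ (h _ ⟨h01, le_rfl⟩)
  refine AbsolutelyContinuousOnInterval.le_of_deriv_nonpos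
    (f' := fun t => -(P.kR * gradSq P.M (x t j).2.1)) h01
    (absolutelyContinuous_attitudeCost P.M hac) ?_
  filter_upwards [ae_hasDerivAt_of_solution hx h] with t ht hmem
  obtain ⟨-, hR, -, -⟩ := ht hmem
  constructor
  · exact hasDerivAt_attitudeCost P.M P.kR hR
  · have : 0 ≤ gradSq P.M (x t j).2.1 := by
      rw [gradSq, ← frobenius_norm_sq]; positivity
    have := mul_nonneg hkR.le this
    linarith

lemma solution_jump (hx : IsHybridSolution (P.closedLoop ω a) D x) (hkc : P.kc ≠ 0)
    (hU : ∀ u ∈ P.U, ‖u‖ = 1) {t : ℝ} {j : ℕ} (h0 : (t, j) ∈ D) (h1 : (t, j + 1) ∈ D) :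
    attitudeCost P.M (x t (j + 1)).2.1 ≤ attitudeCost P.M (x t j).2.1 - P.δ ∧
      (x t (j + 1)).2.2 = (x t j).2.2 := by
  obtain ⟨⟨hs, hgap⟩, Xq, hq, he⟩ := hx.jump t j h0 h1
  rw [he]
  refine ⟨?_, rfl⟩
  have := P.attitudeCost_jump hkc hU hs hq
  change attitudeCost P.M ((x t j).2.1 * rotPart Xq) ≤ _
  linarith

end Solution

end Params

/-! ### Exponential stability -/

namespace Params

variable {n : ℕ} (P : Params n)

/-- Lyapunov function of the closed loop: a multiple of the attitude potential plus the Lyapunov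
function of the translational subsystem. -/
noncomputable def lyapunov (N ε : ℝ) (x : State) : ℝ :=
  N * attitudeCost P.M x.2.1 + transLyapunov (P.kc * P.kv) ε x.2.2.1 x.2.2.2.1

/-- Along flows `lyapunov N ε` decays exponentially if its derivative does so on the flow set. -/
lemma lyapunov_flow {P : Params n} {ω a : ℝ → V3} {D : Set (ℝ × ℕ)} {x : ℝ → ℕ → State}
    {N ε lam : ℝ} (hx : IsHybridSolution (P.closedLoop ω a) D x)
    (hdecay : ∀ y ∈ (P.closedLoop ω a).flowSet,
      -(N * (P.kR * gradSq P.M y.2.1)) + transLyapunovDeriv (P.kc * P.kv) ε y.2.2.1 y.2.2.2.1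
        (-(P.kc * P.kp) • y.2.2.1 + y.2.2.2.1) (-(P.kc * P.kv) • y.2.2.1 + mv (1 - y.2.1) P.g) ≤
      -lam * P.lyapunov N ε y)
    {j : ℕ} {t₀ t₁ : ℝ} (h01 : t₀ ≤ t₁) (h : ∀ t ∈ Set.Icc t₀ t₁, (t, j) ∈ D) :
    Real.exp (lam * t₁) * P.lyapunov N ε (x t₁ j) ≤
      Real.exp (lam * t₀) * P.lyapunov N ε (x t₀ j) := by
  have hac := hx.locallyAC j t₀ (h _ ⟨le_rfl, h01⟩) t₁ (h _ ⟨h01, le_rfl⟩)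
  have hexp : AbsolutelyContinuousOnInterval (fun t => Real.exp (lam * t)) t₀ t₁ :=
    ContDiffOn.absolutelyContinuousOnInterval (by fun_prop)
  have hL : AbsolutelyContinuousOnInterval (fun t => P.lyapunov N ε (x t j)) t₀ t₁ :=
    ((absolutelyContinuous_attitudeCost P.M hac).const_mul N).add
      (absolutelyContinuous_transLyapunov (P.kc * P.kv) ε hac)
  refine AbsolutelyContinuousOnInterval.le_of_deriv_nonpos (f' := fun t =>
    Real.exp (lam * t) * (lam * 1) * P.lyapunov N ε (x t j) + Real.exp (lam * t) *
      (N * -(P.kR * gradSq P.M (x t j).2.1) + transLyapunovDeriv (P.kc * P.kv) ε (x t j).2.2.1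
        (x t j).2.2.2.1 (-(P.kc * P.kp) • (x t j).2.2.1 + (x t j).2.2.2.1)
        (-(P.kc * P.kv) • (x t j).2.2.1 + mv (1 - (x t j).2.1) P.g))) h01 (hexp.fun_mul hL) ?_
  filter_upwards [ae_hasDerivAt_of_solution hx h] with t ht hmem
  obtain ⟨hflow, hR, hp, hv⟩ := ht hmem
  constructor
  · exact (((hasDerivAt_id t).const_mul lam).exp).mul
      (((hasDerivAt_attitudeCost P.M P.kR hR).const_mul N).add (hasDerivAt_transLyapunov _ ε hp hv))
  · have h1 := mul_le_mul_of_nonneg_left (hdecay _ hflow) (Real.exp_pos (lam * t)).le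
    beta_reduce
    linarith

/-- On the flow set the derivative of a suitable `lyapunov N ε` is at most `-lam * lyapunov N ε`,
and this function is comparable with the squared distance to the attractor. -/
lemma exists_lyapunov (hp : ∃ i j l : Fin n, ¬ Collinear ℝ {P.p i, P.p j, P.p l})
    (hk : ∀ i, 0 < P.k i) (hkR : 0 < P.kR) (hkp : 0 < P.kp) (hkv : 0 < P.kv)
    (hUfin : P.U.Finite) (hUne : P.U.Nonempty) (hU : ∀ u ∈ P.U, ‖u‖ = 1)
    (hδM : P.δ < (1 - Real.cos P.θ) * P.DeltaMStar) (ω a : ℝ → V3) :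
    ∃ N ε lam A B : ℝ, 0 ≤ N ∧ 0 < lam ∧ 0 < A ∧ 0 < B ∧
      (∀ y ∈ stateSpace, A * errorSq y ≤ P.lyapunov N ε y ∧ P.lyapunov N ε y ≤ B * errorSq y) ∧
      ∀ y ∈ (P.closedLoop ω a).flowSet,
        -(N * (P.kR * gradSq P.M y.2.1)) + transLyapunovDeriv (P.kc * P.kv) ε y.2.2.1 y.2.2.2.1
          (-(P.kc * P.kp) • y.2.2.1 + y.2.2.2.1) (-(P.kc * P.kv) • y.2.2.1 + mv (1 - y.2.1) P.g) ≤
        -lam * P.lyapunov N ε y := by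
  have hkc := P.kc_pos hp hk
  obtain ⟨c₀, c₁, hc₀, hc₁, h₀, h₁⟩ := P.exists_axisGain_bounds hp hk
  obtain ⟨κ, hκ, hgrad⟩ := P.exists_gradSq_ge hp hk hUfin hUne hU hδM
  obtain ⟨ε, m₀, m₁, α, β, hm₀, hm₁, hα, hβ, hW, hW'⟩ :=
    exists_transLyapunov (mul_pos hkc hkp) (mul_pos hkc hkv)
  -- `N` makes the decay of the potential absorb the gravity term `(I - R̃) g`
  obtain ⟨N, hN⟩ : ∃ N, N = (β * (4 / c₀ * ‖P.g‖ ^ 2) + 1) / (P.kR * κ) := ⟨_, rfl⟩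
  have hN0 : 0 < N := by rw [hN]; positivity
  have hNeq : N * (P.kR * κ) = β * (4 / c₀ * ‖P.g‖ ^ 2) + 1 := by
    rw [hN]; field_simp
  clear hN
  refine ⟨N, ε, min (1 / N) (α / m₁), min (2 * N * c₀) m₀, max (2 * N * c₁) m₁, hN0.le,
    by positivity, by positivity, by positivity, ?_, ?_⟩
  · intro y hy
    obtain ⟨hV0, hV1⟩ := attitudeCost_bounds P.M_transpose h₀ h₁ hy.2.1
    obtain ⟨hW0, hW1⟩ := hW y.2.2.1 y.2.2.2.1
    rw [lyapunov, errorSq]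
    set E := ‖y.2.1 - 1‖ ^ 2
    set F := ‖y.2.2.1‖ ^ 2 + ‖y.2.2.2.1‖ ^ 2 with hF
    have hE0 : 0 ≤ E := by positivity
    have hF0 : 0 ≤ F := by positivity
    have a1 := mul_le_mul_of_nonneg_right (min_le_left (2 * N * c₀) m₀) hE0
    have a2 := mul_le_mul_of_nonneg_right (min_le_right (2 * N * c₀) m₀) hF0
    have a3 := mul_le_mul_of_nonneg_right (le_max_left (2 * N * c₁) m₁) hE0
    have a4 := mul_le_mul_of_nonneg_right (le_max_right (2 * N * c₁) m₁) hF0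
    have b1 := mul_le_mul_of_nonneg_left hV0 hN0.le
    have b2 := mul_le_mul_of_nonneg_left hV1 hN0.le
    rw [add_assoc, ← hF]
    constructor <;> linarith
  · intro y hy
    have hR := hy.1.2.1
    have hg := hgrad _ hR fun u hu =>
      (P.costDrop_le_gap hkc.ne' hUfin hU hy.1 hu).trans hy.2
    obtain ⟨hV0, hV1⟩ := attitudeCost_bounds P.M_transpose h₀ h₁ hR
    obtain ⟨hW0, hW1⟩ := hW y.2.2.1 y.2.2.2.1
    have hd := hW' y.2.2.1 y.2.2.2.1 (mv (1 - y.2.1) P.g)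
    have hVnn : 0 ≤ attitudeCost P.M y.2.1 := le_trans (by positivity) hV0
    rw [lyapunov]
    set V := attitudeCost P.M y.2.1
    set F := ‖y.2.2.1‖ ^ 2 + ‖y.2.2.2.1‖ ^ 2
    set W := transLyapunov (P.kc * P.kv) ε y.2.2.1 y.2.2.2.1
    have hF0 : 0 ≤ F := by positivity
    have hh : ‖mv (1 - y.2.1) P.g‖ ^ 2 ≤ 4 / c₀ * ‖P.g‖ ^ 2 * V := by
      have e1 : ‖y.2.1 - 1‖ ^ 2 ≤ 4 / c₀ * V := by
        rw [div_mul_eq_mul_div, le_div_iff₀ hc₀]; linarith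
      calc ‖mv (1 - y.2.1) P.g‖ ^ 2 ≤ (‖1 - y.2.1‖ * ‖P.g‖) ^ 2 := by
            gcongr; exact norm_mv_le _ _
        _ = ‖y.2.1 - 1‖ ^ 2 * ‖P.g‖ ^ 2 := by rw [mul_pow, norm_sub_rev]
        _ ≤ 4 / c₀ * V * ‖P.g‖ ^ 2 := by gcongr
        _ = _ := by ring
    have b1 := mul_le_mul_of_nonneg_left hg (mul_pos hN0 hkR).le
    have b2 := mul_le_mul_of_nonneg_left hh hβ
    have b3 : N * P.kR * (κ * V) = (β * (4 / c₀ * ‖P.g‖ ^ 2) + 1) * V := by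
      rw [← hNeq]; ring
    have b4 : min (1 / N) (α / m₁) * (N * V) ≤ V := by
      calc _ ≤ 1 / N * (N * V) := by gcongr; exact min_le_left _ _
        _ = V := by field_simp
    have b5 : min (1 / N) (α / m₁) * W ≤ α * F := by
      calc _ ≤ min (1 / N) (α / m₁) * (m₁ * F) := by gcongr
        _ ≤ α / m₁ * (m₁ * F) := by gcongr; exact min_le_right _ _
        _ = α * F := by field_simp
    linarith

/-- Every jump consumes at least `δ` of the potential, which is bounded on `SO(3)`. -/
lemma exists_jump_bound (hp : ∃ i j l : Fin n, ¬ Collinear ℝ {P.p i, P.p j, P.p l})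
    (hk : ∀ i, 0 < P.k i) (hkR : 0 < P.kR) (hU : ∀ u ∈ P.U, ‖u‖ = 1) (hδ : 0 < P.δ)
    (ω a : ℝ → V3) : ∃ J : ℝ, ∀ (D : Set (ℝ × ℕ)) (x : ℝ → ℕ → State),
      IsHybridSolution (P.closedLoop ω a) D x → ∀ t j, (t, j) ∈ D → (j : ℝ) ≤ J := by
  have hkc := P.kc_pos hp hk
  obtain ⟨c₀, c₁, hc₀, hc₁, h₀, h₁⟩ := P.exists_axisGain_bounds hp hk
  refine ⟨2 * c₁ / P.δ, fun D x hx t j htj => ?_⟩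
  have h := hx.timeDomain.add_mul_le (φ := fun t j => attitudeCost P.M (x t j).2.1) (d := P.δ)
    (fun j t₀ t₁ h01 h => attitudeCost_flow hx hkR h01 h)
    (fun t j h0 h1 => (solution_jump hx hkc.ne' hU h0 h1).1) htj
  have hV := (attitudeCost_bounds P.M_transpose h₀ h₁ (hx.mem_space t j htj).2.1).1
  have h00 := (hx.mem_space 0 0 hx.timeDomain.zero_mem).2.1
  have hV0 := (attitudeCost_bounds P.M_transpose h₀ h₁ h00).2
  have h8 := norm_sub_one_sq_le h00
  have hVnn : 0 ≤ attitudeCost P.M (x t j).2.1 := le_trans (by positivity) hV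
  rw [le_div_iff₀ hδ]
  nlinarith

end Params

theorem theorem1 {n : ℕ} (P : Params n)
    -- three non-collinear landmarks
    (hp : ∃ i j l : Fin n, ¬ Collinear ℝ {P.p i, P.p j, P.p l})
    -- positive gains
    (hk : ∀ i, 0 < P.k i) (hkR : 0 < P.kR) (hkp : 0 < P.kp) (hkv : 0 < P.kv)
    -- the transformation set and the gap
    (hθ : P.θ ∈ Set.Ioc 0 Real.pi)
    (hUfin : P.U.Finite) (hUne : P.U.Nonempty) (hU : ∀ u ∈ P.U, ‖u‖ = 1)
    (hδ : 0 < P.δ) (hδM : P.δ < (1 - Real.cos P.θ) * P.DeltaMStar)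
    -- angular velocity and apparent acceleration
    (ω a : ℝ → V3) (hω : ContinuousOn ω (Set.Ici 0)) (ha : ContinuousOn a (Set.Ici 0)) :
    (∀ (D : Set (ℝ × ℕ)) (x : ℝ → ℕ → Params.State),
      IsHybridSolution (P.closedLoop ω a) D x → {j : ℕ | ∃ t, (t, j) ∈ D}.Finite) ∧
    IsUniformlyGloballyExponentiallyStable (P.closedLoop ω a)
      Params.stateDist Params.attractor := by
  have hkc := P.kc_pos hp hk
  obtain ⟨J, hJ⟩ := P.exists_jump_bound hp hk hkR hU hδ ω a
  obtain ⟨N, ε, lam, A, B, hN, hlam, hA, hB, hcomp, hdecay⟩ :=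
    P.exists_lyapunov hp hk hkR hkp hkv hUfin hUne hU hδM ω a
  constructor
  · intro D x hx
    refine (Set.finite_Iic ⌊J⌋₊).subset ?_
    rintro j ⟨t, ht⟩
    exact Nat.le_floor (hJ D x hx t j ht)
  -- the factor `exp (lam * J / 2)` pays for the at most `J` jumps
  refine ⟨√(B / A) * Real.exp (lam / 2 * J), lam / 2, by positivity, by positivity,
    fun D x hx t j htj => ?_⟩
  have hs := hx.mem_space t j htj
  have hs0 := hx.mem_space 0 0 hx.timeDomain.zero_mem
  have h := hx.timeDomain.add_mul_le
    (φ := fun t j => Real.exp (lam * t) * P.lyapunov N ε (x t j)) (d := 0)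
    (fun j t₀ t₁ h01 h => Params.lyapunov_flow hx hdecay h01 h)
    (fun t j h0 h1 => by
      obtain ⟨e1, e2⟩ := Params.solution_jump hx hkc.ne' hU h0 h1
      have : P.lyapunov N ε (x t (j + 1)) ≤ P.lyapunov N ε (x t j) := by
        rw [Params.lyapunov, Params.lyapunov, e2]
        gcongr
        linarith
      rw [sub_zero]
      gcongr) htj
  beta_reduce at h
  rw [zero_mul, add_zero, mul_zero, Real.exp_zero, one_mul] at h
  have hsq : Params.errorSq (x t j) ≤ B / A * Real.exp (-lam * t) * Params.errorSq (x 0 0) := by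
    have h1 := (hcomp _ hs).1
    have h2 := (hcomp _ hs0).2
    have h3 : P.lyapunov N ε (x t j) ≤ Real.exp (-lam * t) * (B * Params.errorSq (x 0 0)) := by
      calc P.lyapunov N ε (x t j)
          = Real.exp (-lam * t) * (Real.exp (lam * t) * P.lyapunov N ε (x t j)) := by
            rw [← mul_assoc, ← Real.exp_add, neg_mul, neg_add_cancel, Real.exp_zero, one_mul]
        _ ≤ _ := mul_le_mul_of_nonneg_left (h.trans h2) (Real.exp_pos _).le
    have h4 := h1.trans h3
    rw [← le_div_iff₀' hA] at h4
    refine h4.trans_eq ?_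
    ring
  rw [Params.distToSet_attractor hs, Params.distToSet_attractor hs0]
  have hexp : √(Real.exp (-lam * t)) = Real.exp (-(lam / 2) * t) := by
    rw [← Real.exp_half]; congr 1; ring
  calc √(Params.errorSq (x t j))
      ≤ √(B / A * Real.exp (-lam * t) * Params.errorSq (x 0 0)) := Real.sqrt_le_sqrt hsq
    _ = √(B / A) * Real.exp (-(lam / 2) * t) * √(Params.errorSq (x 0 0)) := by
      rw [Real.sqrt_mul (by positivity), Real.sqrt_mul (by positivity), hexp]
    _ ≤ √(B / A) * (Real.exp (lam / 2 * J) * Real.exp (-(lam / 2) * (t + j))) *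
        √(Params.errorSq (x 0 0)) := by
      gcongr
      rw [← Real.exp_add]
      refine Real.exp_le_exp.2 ?_
      nlinarith [hJ D x hx t j htj]
    _ = _ := by ring
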